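/- Let $q=(q_n)_{n\ge 0}$ be a probability distribution on $\{0,1,2,\dots\}$ with $q_0=0$, $q_1\neq 1$, mean $m=\sum_n n q_n$ and $\sum_n n^2 q_n<\infty$. Let $\mathbf P_q$ be the law of the Galton–Watson tree with offspring distribution $q$: the rooted tree in which the numbers of children of the vertices are i.i.d. with distribution $q$. For a rooted tree $\Gamma$, let $\partial\Gamma$ be the set of infinite non-self-intersecting paths from the root, with the $\sigma$-algebra generated by the sets of paths through a given vertex, and for $x,y\in\partial\Gamma$ let $|x\wedge y|\in\{0,1,2,\dots\}\cup\{\infty\}$ be the level of the last common vertex of $x$ and $y$ ($\infty$ if $x=y$). An increasing gauge function is a nondecreasing $f:\{0,1,2,\dots\}\to(0,\infty)$, extended by $f(\infty)=\sup_n f(n)\in(0,\infty]$. The capacity of $\Gamma$ in gauge $f$ is $$\mathrm{Cap}_f(\Gamma)=\Big[\inf_\theta \iint f(|x\wedge y|)\,d\theta(x)\,d\theta(y)\Big]^{-1},$$ where $\theta$ ranges over the probability measures on $\partial\Gamma$ and $1/\infty=0$. Then $\mathbf P_q$-almost every $\Gamma$ has the property that, for every increasing gauge function $f$, $$\mathrm{Cap}_f(\Gamma)>0\quad\text{if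 and only if}\quad \sum_{n=1}^\infty m^{-n}f(n)<\infty .$$ In particular, if $q'$ is another distribution on $\{0,1,2,\dots\}$ with $q'_0=0$, the same mean $m$ and $\sum_n n^2q'_n<\infty$, then for $\mathbf P_q\times\mathbf P_{q'}$-almost every pair $(\Gamma,\Gamma')$ the trees $\Gamma$ and $\Gamma'$ are capacity-equivalent: for every increasing gauge function $f$, $\mathrm{Cap}_f(\Gamma)>0$ if and only if $\mathrm{Cap}_f(\Gamma')>0$. -/

import Mathlib

open MeasureTheory
open scoped ENNReal

/-- A rooted tree in Ulam–Harris coding: vertices are finite words of natural numbers, the root is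
the empty word, and the parent of `v ++ [i]` is `v`. -/
structure WordTree where
  verts : Set (List ℕ)
  root_mem : [] ∈ verts
  parent_mem : ∀ (v : List ℕ) (i : ℕ), v ++ [i] ∈ verts → v ∈ verts

/-- The family tree of the offspring numbers `N`: a vertex `u` of the tree has exactly the `N u`
children `u ++ [0], …, u ++ [N u - 1]`. -/
def familyTree (N : List ℕ → ℕ) : WordTree where
  verts := {v | ∀ (u : List ℕ) (i : ℕ), u ++ [i] <+: v → i < N u}
  root_mem := fun u i h => by simp at h
  parent_mem := fun v j h u i hu => h u i (hu.trans (List.prefix_append v [j]))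

/-- The law under which the numbers of children `N v`, one for each word `v`, are independent
with common distribution `q`. The Galton–Watson tree with offspring distribution `q` is
`familyTree N` with `N` chosen from this law. -/
noncomputable def galtonWatson (q : PMF ℕ) : Measure (List ℕ → ℕ) :=
  Measure.infinitePi fun _ : List ℕ => q.toMeasure

/-- The vertex at level `n` on the path from the root given by the sequence of letters `x`. -/
def vertexAt (x : ℕ → ℕ) (n : ℕ) : List ℕ := (List.range n).map x

namespace WordTree

/-- The boundary: infinite paths from the root that never turn back. It carries the σ-algebra
inherited from the product `ℕ → ℕ`, which is the one generated by the sets of paths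
through a given vertex. -/
def boundary (Γ : WordTree) : Set (ℕ → ℕ) := {x | ∀ n, vertexAt x n ∈ Γ.verts}

/-- The level `|x ∧ y|` of the last common vertex of two paths; it is `⊤` when `x = y`. -/
noncomputable def meetLevel (x y : ℕ → ℕ) : ℕ∞ :=
  ⨆ (n : ℕ) (_ : vertexAt x n = vertexAt y n), (n : ℕ∞)

/-- The energy `∬ K(x, y) dθ(x) dθ(y)`. -/
noncomputable def energy {Γ : WordTree} (K : Γ.boundary → Γ.boundary → ℝ≥0∞)
    (θ : Measure Γ.boundary) : ℝ≥0∞ :=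
  ∫⁻ y, ∫⁻ x, K x y ∂θ ∂θ

/-- The capacity of `E ⊆ ∂Γ` for the kernel `K`: the reciprocal of the infimum of the energies of
the probability measures (unit flows) on `∂Γ` that are carried by `E`. -/
noncomputable def kernelCap {Γ : WordTree} (K : Γ.boundary → Γ.boundary → ℝ≥0∞)
    (E : Set Γ.boundary) : ℝ≥0∞ :=
  (⨅ (θ : ProbabilityMeasure Γ.boundary) (_ : (θ : Measure Γ.boundary) E = 1),
    energy K (θ : Measure Γ.boundary))⁻¹

end WordTree

/-- Increasing gauge functions: positive and nondecreasing. -/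
structure IsIncreasingGauge (f : ℕ → ℝ) : Prop where
  pos : ∀ n, 0 < f n
  mono : Monotone f

/-- The gauge as a function on `ℕ ∪ {∞}`, with `f(∞) = sup f`, the limit of an increasing `f`. -/
noncomputable def gaugeExt (f : ℕ → ℝ) : ℕ∞ → ℝ≥0∞ :=
  ENat.recTopCoe (⨆ n, ENNReal.ofReal (f n)) fun n => ENNReal.ofReal (f n)

namespace WordTree

/-- The capacity of a tree in gauge `f`: the capacity of its whole boundary for the kernel
`K(x, y) = f(|x ∧ y|)`. -/
noncomputable def cap (Γ : WordTree) (f : ℕ → ℝ) : ℝ≥0∞ :=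
  kernelCap (Γ := Γ) (fun x y => gaugeExt f (meetLevel x y)) Set.univ

/-- Two trees are capacity-equivalent if they have positive capacity for precisely the same
increasing gauge functions. -/
def CapacityEquivalent (Γ Γ' : WordTree) : Prop :=
  ∀ f : ℕ → ℝ, IsIncreasingGauge f → (0 < Γ.cap f ↔ 0 < Γ'.cap f)

end WordTree

/-!
The number of vertices in generation `n` of the tree, divided by `m ^ n`, converges almost surely
and in `L²` to a limit `W`. If `h` is a centred functional of trees, then by the branching
property (`measurePreserving_split`) the sum of `h` over the subtrees of generation `n` is centred
and has second moment `m ^ n * E h ^ 2` (`memLp_genSum`); applied to the number of children of the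
root minus `m`, this shows that the increments of the normalised sizes decrease geometrically in
`L²`. The event `W = 0` is inherited by the subtrees of the children of the root, and so has
probability `0` or `1`; as `W` is not almost surely `0`, it is positive on all subtrees at once.

For a probability measure `θ` on the boundary, summation by parts (`energy_eq_tsum`) gives
`f 0 + ∑ n, (f (n + 1) - f n) * ∑ |v| = n + 1, θ(v) ^ 2` as its energy, where `θ(v)` is the mass of
the paths through `v`. By the same token the series `∑ m ^ (-n) * f n` converges if and only if
`∑ m ^ (-n - 1) * (f (n + 1) - f n)` does (`summable_gauge_iff`).

* If some `θ` has finite energy, the series converges: Cauchy–Schwarz bounds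
  `∑ |v| = n, θ(v) ^ 2` below by the reciprocal of the size of generation `n`, which is at least a
  multiple of `m ^ (-n)` (`summable_of_cap_pos`).
* If the series converges, the flow with `θ(v) = m ^ (-|v|) * W(v) / W(root)`, where `W(v)` is the
  limit for the subtree of `v`, has finite energy as soon as `∑ |v| = n, W(v) ^ 2` is at most a
  multiple of `m ^ n`. This holds almost surely for all `n` simultaneously (`ae_exists_genSum_le`),
  by a truncation argument as in the strong law of large numbers, which needs only
  `E W ^ 2 < ∞`. The flow itself is the law of the path that chooses one child at every vertex,
  independently, with probabilities proportional to `W` (`exists_flow`).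

All almost sure statements involve the tree only, not the gauge, so that they give one null set
for all gauges. The second assertion follows from the first, as the criterion depends on `m` only.
-/

open Filter Topology

/-! ### The branching property -/

/-- The offspring numbers seen from the vertex `v`: `familyTree (below N v)` is the subtree of the
descendants of `v`. -/
def below (N : List ℕ → ℕ) (v : List ℕ) : List ℕ → ℕ := fun w => N (v ++ w)

lemma below_nil (N : List ℕ → ℕ) : below N [] = N := rfl

lemma below_append (N : List ℕ → ℕ) (v w : List ℕ) :
    below N (v ++ w) = below (below N v) w := by
  funext u
  simp [below]

lemma measurable_below (v : List ℕ) : Measurable fun N : List ℕ → ℕ => below N v := by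
  unfold below
  fun_prop

instance (q : PMF ℕ) : IsProbabilityMeasure (galtonWatson q) := by
  unfold galtonWatson
  infer_instance

lemma measurePreserving_below (q : PMF ℕ) (v : List ℕ) :
    MeasurePreserving (fun N => below N v) (galtonWatson q) (galtonWatson q) :=
  ⟨measurable_below v, Measure.map_infinitePi_infinitePi_of_inj
    (P := fun _ : List ℕ => q.toMeasure) (List.append_right_injective v)⟩

/-- The branching property: the number of children of the root and the subtrees at the words `[i]`
are independent, and the subtrees have the same law as the whole tree. -/
lemma measurePreserving_split (q : PMF ℕ) :
    MeasurePreserving (fun N : List ℕ → ℕ => (N [], fun i : ℕ => below N [i])) (galtonWatson q)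
      (q.toMeasure.prod (Measure.infinitePi fun _ : ℕ => galtonWatson q)) := by
  have hsplit : Measurable fun N : List ℕ → ℕ => (N [], fun i : ℕ => below N [i]) :=
    (measurable_pi_apply _).prodMk (measurable_pi_iff.2 fun i => measurable_below [i])
  refine ⟨hsplit, ?_⟩
  -- `glue` puts a tree together from the offspring number of the root and those of the other words.
  let glue : ℕ × (ℕ × List ℕ → ℕ) → List ℕ → ℕ := fun p v =>
    match v with
    | [] => p.1
    | i :: w => p.2 (i, w)
  have hglue : Measurable glue := by
    refine measurable_pi_iff.2 fun v => ?_
    cases v with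
    | nil => exact measurable_fst
    | cons i w => exact (measurable_pi_apply (i, w)).comp measurable_snd
  have hmap : (q.toMeasure.prod (Measure.infinitePi fun _ : ℕ × List ℕ => q.toMeasure)).map glue
      = galtonWatson q := by
    refine Measure.eq_infinitePi _ fun s t ht => ?_
    rw [Measure.map_apply hglue (.pi s.countable_toSet fun _ _ => ht _)]
    have hinj : Function.Injective fun p : ℕ × List ℕ => p.1 :: p.2 := by
      rintro ⟨i, v⟩ ⟨j, w⟩ h
      simpa using h
    classical
    have hpre : glue ⁻¹' ((s : Set (List ℕ)).pi t)
        = (if [] ∈ s then t [] else Set.univ) ×ˢ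
          ((s.preimage _ hinj.injOn : Finset (ℕ × List ℕ)) : Set (ℕ × List ℕ)).pi
            fun p => t (p.1 :: p.2) := by
      ext ⟨k, ω⟩
      simp only [Set.mem_preimage, Set.mem_pi, Finset.mem_coe, Set.mem_prod, Finset.mem_preimage,
        Prod.forall]
      constructor
      · intro h
        refine ⟨?_, fun i w hw => h _ hw⟩
        split_ifs with h0
        · exact h [] h0
        · trivial
      · rintro ⟨h0, h1⟩ v hv
        cases v with
        | nil => simpa [hv] using h0
        | cons i w => exact h1 i w hv
    rw [hpre, Measure.prod_prod, Measure.infinitePi_pi _ fun _ _ => ht _,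
      Finset.prod_preimage' _ _ _ fun v => q.toMeasure (t v)]
    have hrange : ∀ v : List ℕ, v ∈ Set.range (fun p : ℕ × List ℕ => p.1 :: p.2) ↔ v ≠ [] := by
      intro v
      cases v <;> simp
    simp only [hrange]
    split_ifs with h0
    · rw [← Finset.mul_prod_erase s _ h0, Finset.filter_ne']
    · rw [Finset.filter_true_of_mem fun v hv => ne_of_mem_of_not_mem hv h0, measure_univ, one_mul]
  have hcurry := Measure.infinitePi_map_curry (fun (_ : ℕ) (_ : List ℕ) => q.toMeasure)
  refine (congrArg (Measure.map _) hmap.symm).trans ?_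
  rw [Measure.map_map hsplit hglue]
  have hcomp : (fun N : List ℕ → ℕ => (N [], fun i : ℕ => below N [i])) ∘ glue
      = Prod.map id (MeasurableEquiv.curry ℕ (List ℕ) ℕ) := rfl
  rw [hcomp, ← Measure.map_prod_map _ _ measurable_id (MeasurableEquiv.measurable _),
    Measure.map_id, hcurry]
  rfl

/-! ### Generations of a family tree -/

lemma cons_mem_verts_familyTree {N : List ℕ → ℕ} {i : ℕ} {v : List ℕ} :
    i :: v ∈ (familyTree N).verts ↔ i < N [] ∧ v ∈ (familyTree (below N [i])).verts := by
  constructor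
  · intro h
    exact ⟨h [] i (by simp), fun u j hu => h (i :: u) j (by simpa using hu)⟩
  · rintro ⟨hi, hv⟩ u j hu
    cases u with
    | nil =>
      obtain rfl : j = i := by simpa using hu
      exact hi
    | cons a u =>
      obtain ⟨rfl, huv⟩ := List.cons_prefix_cons.1 hu
      exact hv u j huv

lemma append_singleton_mem_verts_familyTree {N : List ℕ → ℕ} {i : ℕ} {v : List ℕ} :
    v ++ [i] ∈ (familyTree N).verts ↔ v ∈ (familyTree N).verts ∧ i < N v :=
  ⟨fun h => ⟨(familyTree N).parent_mem v i h, h v i (List.prefix_refl _)⟩, fun h u j hu => by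
    rcases List.prefix_concat_iff.1 hu with hu | hu
    · obtain ⟨rfl, hij⟩ := List.append_inj' hu rfl
      obtain rfl : j = i := by simpa using hij
      exact h.2
    · exact h.1 u j hu⟩

/-- The vertices at distance `n` from the root of `familyTree N`. -/
def generation : (List ℕ → ℕ) → ℕ → Finset (List ℕ)
  | _, 0 => {[]}
  | N, n + 1 => (Finset.range (N [])).biUnion fun i =>
      (generation (below N [i]) n).map ⟨List.cons i, List.cons_injective⟩

lemma mem_generation {N : List ℕ → ℕ} {n : ℕ} {v : List ℕ} :
    v ∈ generation N n ↔ v.length = n ∧ v ∈ (familyTree N).verts := by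
  induction n generalizing N v with
  | zero =>
    simp only [generation, Finset.mem_singleton, List.length_eq_zero_iff]
    exact ⟨fun h => ⟨h, h ▸ (familyTree N).root_mem⟩, fun h => h.1⟩
  | succ n ih =>
    cases v with
    | nil => simp [generation]
    | cons i v => simp [generation, cons_mem_verts_familyTree, ih, and_left_comm]

/-- The sum of the values of a functional of trees over the subtrees of the vertices in
generation `n`. -/
def genSum {M : Type*} [AddCommMonoid M] (n : ℕ) (h : (List ℕ → ℕ) → M) (N : List ℕ → ℕ) : M :=
  ∑ v ∈ generation N n, h (below N v)

section genSum

variable {M : Type*} [AddCommMonoid M] (h : (List ℕ → ℕ) → M) (N : List ℕ → ℕ)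

@[simp] lemma genSum_zero : genSum 0 h = h := by
  funext N
  simp [genSum, generation, below_nil]

lemma sum_generation_succ (n : ℕ) (g : List ℕ → M) :
    ∑ v ∈ generation N (n + 1), g v
      = ∑ i ∈ Finset.range (N []), ∑ v ∈ generation (below N [i]) n, g (i :: v) := by
  rw [generation, Finset.sum_biUnion]
  · simp
  · intro i _ j _ hij
    simp only [Function.onFun, Finset.disjoint_left, Finset.mem_map, Function.Embedding.coeFn_mk]
    rintro _ ⟨v, _, rfl⟩ ⟨w, _, hw⟩
    exact hij (List.cons.inj hw).1.symm

lemma genSum_one : genSum 1 h N = ∑ i ∈ Finset.range (N []), h (below N [i]) := by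
  rw [genSum, sum_generation_succ]
  simp [generation]

lemma genSum_succ (n : ℕ) : genSum (n + 1) h = genSum 1 (genSum n h) := by
  funext N
  rw [genSum_one, genSum, sum_generation_succ]
  rfl

lemma genSum_succ' (n : ℕ) : genSum (n + 1) h = genSum n (genSum 1 h) := by
  induction n with
  | zero => simp
  | succ n ih => rw [genSum_succ, ih, ← genSum_succ]

end genSum

lemma measurable_sum_range {Ω M : Type*} [MeasurableSpace Ω] [AddCommMonoid M] [MeasurableSpace M]
    [MeasurableAdd₂ M] {h : Ω → M} (hh : Measurable h) :
    Measurable fun p : ℕ × (ℕ → Ω) => ∑ i ∈ Finset.range p.1, h (p.2 i) := by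
  refine measurable_from_prod_countable_right fun k => ?_
  change Measurable fun ω : ℕ → Ω => ∑ i ∈ Finset.range k, h (ω i)
  exact Finset.measurable_sum _ fun i _ => hh.comp (measurable_pi_apply i)

lemma measurable_genSum {M : Type*} [AddCommMonoid M] [MeasurableSpace M] [MeasurableAdd₂ M]
    {h : (List ℕ → ℕ) → M} (hh : Measurable h) (n : ℕ) : Measurable (genSum n h) := by
  induction n with
  | zero => simpa using hh
  | succ n ih =>
    rw [genSum_succ, funext fun N => genSum_one (genSum n h) N]
    exact (measurable_sum_range ih).comp (f := fun N : List ℕ → ℕ => (N [], fun i => below N [i]))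
      ((measurable_pi_apply []).prodMk (measurable_pi_iff.2 fun i => measurable_below [i]))

/-! ### Moments of sums over a generation -/

section moments

variable {q : PMF ℕ}

lemma lintegral_genSum_one {h : (List ℕ → ℕ) → ℝ≥0∞} (hh : Measurable h) :
    ∫⁻ N, genSum 1 h N ∂galtonWatson q
      = (∫⁻ k : ℕ, (k : ℝ≥0∞) ∂q.toMeasure) * ∫⁻ N, h N ∂galtonWatson q := by
  have hF : Measurable fun p : ℕ × (ℕ → List ℕ → ℕ) => ∑ i ∈ Finset.range p.1, h (p.2 i) :=
    measurable_sum_range hh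
  have hone : ∀ i : ℕ, ∫⁻ ω, h (ω i) ∂(Measure.infinitePi fun _ : ℕ => galtonWatson q)
      = ∫⁻ N, h N ∂galtonWatson q := fun i =>
    (measurePreserving_eval_infinitePi (fun _ : ℕ => galtonWatson q) i).lintegral_comp hh
  simp only [genSum_one]
  rw [(measurePreserving_split q).lintegral_comp hF, lintegral_prod _ hF.aemeasurable,
    ← lintegral_mul_const _ (by fun_prop)]
  refine lintegral_congr fun k => ?_
  dsimp only
  rw [lintegral_finsetSum _ fun i _ => by fun_prop]
  simp [hone]

lemma lintegral_genSum {h : (List ℕ → ℕ) → ℝ≥0∞} (hh : Measurable h) (n : ℕ) :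
    ∫⁻ N, genSum n h N ∂galtonWatson q
      = (∫⁻ k : ℕ, (k : ℝ≥0∞) ∂q.toMeasure) ^ n * ∫⁻ N, h N ∂galtonWatson q := by
  induction n with
  | zero => simp
  | succ n ih =>
    rw [genSum_succ, lintegral_genSum_one (measurable_genSum hh n), ih, pow_succ']
    ring

lemma integral_comp_measurePreserving {α β : Type*} [MeasurableSpace α] [MeasurableSpace β]
    {μ : Measure α} {ν : Measure β} {f : α → β} (hf : MeasurePreserving f μ ν) {g : β → ℝ}
    (hg : Measurable g) : ∫ x, g (f x) ∂μ = ∫ y, g y ∂ν := by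
  rw [← hf.map_eq, integral_map hf.measurable.aemeasurable hg.aestronglyMeasurable]

/-- The sum of `k` independent copies of a centred square integrable variable `h` has second moment
`k` times that of `h`. -/
lemma lintegral_sq_sum_range {Ω : Type*} [MeasurableSpace Ω] {μ : Measure Ω}
    [IsProbabilityMeasure μ] {h : Ω → ℝ} (hh : Measurable h) (h2 : MemLp h 2 μ)
    (h0 : ∫ x, h x ∂μ = 0) (k : ℕ) :
    ∫⁻ ω, ‖∑ i ∈ Finset.range k, h (ω i)‖ₑ ^ 2 ∂(Measure.infinitePi fun _ : ℕ => μ)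
      = k * ∫⁻ x, ‖h x‖ₑ ^ 2 ∂μ := by
  have hev : ∀ i : ℕ, MeasurePreserving (Function.eval i) (Measure.infinitePi fun _ : ℕ => μ) μ :=
    measurePreserving_eval_infinitePi _
  have hL : ∀ i : ℕ, MemLp (fun ω : ℕ → Ω => h (ω i)) 2 (Measure.infinitePi fun _ : ℕ => μ) :=
    fun i => h2.comp_measurePreserving (hev i)
  have hS : MemLp (fun ω : ℕ → Ω => ∑ i ∈ Finset.range k, h (ω i)) 2
      (Measure.infinitePi fun _ : ℕ => μ) := memLp_finsetSum _ fun i _ => hL i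
  have hint : ∀ i : ℕ, ∫ ω, h (ω i) ∂(Measure.infinitePi fun _ : ℕ => μ) = 0 := fun i =>
    (integral_comp_measurePreserving (hev i) hh).trans h0
  have hvar := ProbabilityTheory.IndepFun.variance_sum (μ := Measure.infinitePi fun _ : ℕ => μ)
    (X := fun (i : ℕ) (ω : ℕ → Ω) => h (ω i)) (s := Finset.range k) (fun i _ => hL i)
    fun i _ j _ hij => (ProbabilityTheory.iIndepFun_infinitePi (P := fun _ : ℕ => μ)
      (X := fun _ => h) fun _ => hh).indepFun hij
  have hfun : (∑ i ∈ Finset.range k, fun ω : ℕ → Ω => h (ω i))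
      = fun ω => ∑ i ∈ Finset.range k, h (ω i) := by
    funext ω
    simp
  have hS0 : ∫ ω, ∑ i ∈ Finset.range k, h (ω i) ∂(Measure.infinitePi fun _ : ℕ => μ) = 0 := by
    rw [integral_finsetSum _ fun i _ => (hL i).integrable (by norm_num)]
    simp [hint]
  have key : ProbabilityTheory.evariance (fun ω : ℕ → Ω => ∑ i ∈ Finset.range k, h (ω i))
      (Measure.infinitePi fun _ : ℕ => μ) = k * ProbabilityTheory.evariance h μ := by
    have hcomp : ∀ i : ℕ, ProbabilityTheory.variance (fun ω : ℕ → Ω => h (ω i))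
        (Measure.infinitePi fun _ : ℕ => μ) = ProbabilityTheory.variance h μ := fun i => by
      rw [ProbabilityTheory.variance_eq_integral (hL i).aemeasurable,
        ProbabilityTheory.variance_eq_integral h2.aemeasurable, hint, h0]
      exact integral_comp_measurePreserving (hev i) (g := fun x => (h x - 0) ^ 2) (by fun_prop)
    rw [← hS.ofReal_variance_eq, ← h2.ofReal_variance_eq, ← hfun, hvar]
    simp [hcomp, ENNReal.ofReal_mul]
  simpa [ProbabilityTheory.evariance, hS0, h0] using key

lemma lintegral_sq_genSum_one {h : (List ℕ → ℕ) → ℝ} (hh : Measurable h)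
    (h2 : MemLp h 2 (galtonWatson q)) (h0 : ∫ N, h N ∂galtonWatson q = 0) :
    ∫⁻ N, ‖genSum 1 h N‖ₑ ^ 2 ∂galtonWatson q
      = (∫⁻ k : ℕ, (k : ℝ≥0∞) ∂q.toMeasure) * ∫⁻ N, ‖h N‖ₑ ^ 2 ∂galtonWatson q := by
  have hF : Measurable fun p : ℕ × (ℕ → List ℕ → ℕ) => ‖∑ i ∈ Finset.range p.1, h (p.2 i)‖ₑ ^ 2 :=
    (measurable_sum_range hh).enorm.pow_const 2
  simp only [genSum_one]
  rw [(measurePreserving_split q).lintegral_comp hF, lintegral_prod _ hF.aemeasurable,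
    ← lintegral_mul_const _ (by fun_prop)]
  exact lintegral_congr fun k => lintegral_sq_sum_range hh h2 h0 k

lemma integral_genSum_one_eq_zero {h : (List ℕ → ℕ) → ℝ} (hh : Measurable h)
    (h2 : Integrable h (galtonWatson q)) (h0 : ∫ N, h N ∂galtonWatson q = 0)
    (h1 : Integrable (genSum 1 h) (galtonWatson q)) :
    ∫ N, genSum 1 h N ∂galtonWatson q = 0 := by
  have hF : Measurable fun p : ℕ × (ℕ → List ℕ → ℕ) => ∑ i ∈ Finset.range p.1, h (p.2 i) :=
    measurable_sum_range hh
  have hev : ∀ i : ℕ, MeasurePreserving (Function.eval i)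
    (Measure.infinitePi fun _ : ℕ => galtonWatson q) (galtonWatson q) :=
    measurePreserving_eval_infinitePi _
  have hint : ∀ i : ℕ, ∫ ω, h (ω i) ∂(Measure.infinitePi fun _ : ℕ => galtonWatson q) = 0 :=
    fun i => (integral_comp_measurePreserving (hev i) hh).trans h0
  have hsp := measurePreserving_split q
  have hg : genSum 1 h = (fun p : ℕ × (ℕ → List ℕ → ℕ) => ∑ i ∈ Finset.range p.1, h (p.2 i)) ∘
      fun N => (N [], fun i : ℕ => below N [i]) := funext fun N => genSum_one h N
  rw [hg] at h1 ⊢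
  have hFi := (hsp.integrable_comp hF.aestronglyMeasurable).1 h1
  rw [Function.comp_def, integral_comp_measurePreserving hsp hF, integral_prod _ hFi]
  refine integral_eq_zero_of_ae (.of_forall fun k => ?_)
  have := integral_finsetSum (μ := Measure.infinitePi fun _ : ℕ => galtonWatson q)
    (Finset.range k) (f := fun i ω => h (ω i))
    fun i _ => (hev i).integrable_comp_of_integrable h2
  simp [this, hint]

/-- Sums of a centred functional over a generation are centred, and their second moment grows like
the mean size of the generation. -/
lemma memLp_genSum {h : (List ℕ → ℕ) → ℝ} (hh : Measurable h)
    (hq : ∫⁻ k : ℕ, (k : ℝ≥0∞) ∂q.toMeasure ≠ ∞)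
    (h2 : MemLp h 2 (galtonWatson q)) (h0 : ∫ N, h N ∂galtonWatson q = 0) (n : ℕ) :
    MemLp (genSum n h) 2 (galtonWatson q) ∧ ∫ N, genSum n h N ∂galtonWatson q = 0 ∧
      ∫⁻ N, ‖genSum n h N‖ₑ ^ 2 ∂galtonWatson q
        = (∫⁻ k : ℕ, (k : ℝ≥0∞) ∂q.toMeasure) ^ n * ∫⁻ N, ‖h N‖ₑ ^ 2 ∂galtonWatson q := by
  have hmem : ∀ g : (List ℕ → ℕ) → ℝ, Measurable g →
      (MemLp g 2 (galtonWatson q) ↔ ∫⁻ N, ‖g N‖ₑ ^ 2 ∂galtonWatson q < ∞) := fun g hg => by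
    rw [MemLp, and_iff_right hg.aestronglyMeasurable,
      eLpNorm_lt_top_iff_lintegral_rpow_enorm_lt_top (by norm_num) (by norm_num)]
    simp
  induction n with
  | zero => simpa using ⟨h2, h0⟩
  | succ n ih =>
    obtain ⟨ih2, ih0, ihs⟩ := ih
    have hmeas := measurable_genSum hh n
    have hs := lintegral_sq_genSum_one hmeas ih2 ih0
    have hmem1 : MemLp (genSum 1 (genSum n h)) 2 (galtonWatson q) := by
      rw [hmem _ (measurable_genSum hmeas 1), hs]
      exact ENNReal.mul_lt_top hq.lt_top ((hmem _ hmeas).1 ih2)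
    rw [genSum_succ]
    refine ⟨hmem1, integral_genSum_one_eq_zero hmeas (ih2.integrable (by norm_num)) ih0
      (hmem1.integrable (by norm_num)), ?_⟩
    rw [hs, ihs, pow_succ', mul_assoc]

end moments

/-! ### The limit of the normalised generation sizes -/

lemma lintegral_natCast_toMeasure {q : PMF ℕ} {m : ℝ}
    (hmean : HasSum (fun n : ℕ => (n : ℝ) * (q n).toReal) m) :
    ∫⁻ k : ℕ, (k : ℝ≥0∞) ∂q.toMeasure = ENNReal.ofReal m := by
  rw [lintegral_countable', ← hmean.tsum_eq,
    ENNReal.ofReal_tsum_of_nonneg (fun n => by positivity) hmean.summable]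
  refine tsum_congr fun n => ?_
  rw [PMF.toMeasure_apply_singleton _ _ (measurableSet_singleton n), ENNReal.ofReal_mul (by simp),
    ENNReal.ofReal_toReal (q.apply_ne_top n), ENNReal.ofReal_natCast]

lemma one_lt_mean {q : PMF ℕ} {m : ℝ} (hq0 : q 0 = 0) (hq1 : q 1 ≠ 1)
    (hmean : HasSum (fun n : ℕ => (n : ℝ) * (q n).toReal) m) : 1 < m := by
  have hsum : HasSum (fun n : ℕ => (q n).toReal) 1 := by
    have := (ENNReal.hasSum_toReal (f := q) (by simp [q.tsum_coe]))
    rwa [← ENNReal.tsum_toReal_eq q.apply_ne_top, q.tsum_coe, ENNReal.toReal_one] at this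
  obtain ⟨k, hk⟩ : ∃ k, 2 ≤ k ∧ q k ≠ 0 := by
    by_contra! hcon
    refine hq1 ?_
    rw [← q.tsum_coe, tsum_eq_single 1]
    intro n hn
    rcases Nat.lt_or_ge n 2 with h | h
    · obtain rfl : n = 0 := by omega
      exact hq0
    · exact hcon n h
  refine hasSum_lt (fun n => ?_) (i := k) ?_ hsum hmean
  · rcases Nat.eq_zero_or_pos n with rfl | hn
    · simp [hq0]
    · exact le_mul_of_one_le_left ENNReal.toReal_nonneg (Nat.one_le_cast.2 hn)
  · have h0 : 0 < (q k).toReal := ENNReal.toReal_pos hk.2 (q.apply_ne_top k)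
    have h1 : (1 : ℝ) < k := by exact_mod_cast hk.1
    nlinarith

/-- A sequence in `L²` with geometrically decreasing increments converges almost everywhere and
in `L²`. -/
lemma exists_limit_of_eLpNorm_sub_le_geometric {Ω : Type*} [MeasurableSpace Ω] {μ : Measure Ω}
    {X : ℕ → Ω → ℝ} (hX : ∀ n, MemLp (X n) 2 μ) {C r : ℝ≥0∞} (hC : C ≠ ∞) (hr0 : r ≠ 0)
    (hr1 : r < 1) (h : ∀ n, eLpNorm (X (n + 1) - X n) 2 μ ≤ C * r ^ n) :
    ∃ W : Ω → ℝ, Measurable W ∧ MemLp W 2 μ ∧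
      (∀ᵐ x ∂μ, Tendsto (fun n => X n x) atTop (𝓝 (W x))) ∧
      Tendsto (fun n => eLpNorm (X n - W) 2 μ) atTop (𝓝 0) := by
  have hrt : (1 - r)⁻¹ ≠ ∞ := by simpa [tsub_eq_zero_iff_le] using hr1
  have hstep : ∀ N k, eLpNorm (X (N + k) - X N) 2 μ ≤ ∑ j ∈ Finset.range k, C * r ^ (N + j) := by
    intro N k
    induction k with
    | zero => simp
    | succ k ih =>
      rw [Finset.sum_range_succ]
      have : X (N + (k + 1)) - X N = (X (N + k) - X N) + (X (N + k + 1) - X (N + k)) := by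
        rw [← add_assoc]; abel
      rw [this]
      exact (eLpNorm_add_le ((hX _).sub (hX _)).1 ((hX _).sub (hX _)).1 (by norm_num)).trans
        (add_le_add ih (h _))
  have htail : ∀ N n, N ≤ n → eLpNorm (X n - X N) 2 μ ≤ C * (1 - r)⁻¹ * r ^ N := by
    intro N n hn
    obtain ⟨k, rfl⟩ := Nat.exists_eq_add_of_le hn
    refine (hstep N k).trans ((ENNReal.sum_le_tsum _).trans_eq ?_)
    simp only [pow_add]
    rw [ENNReal.tsum_mul_left, ENNReal.tsum_mul_left, ENNReal.tsum_geometric]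
    ring
  have hcau : ∀ N n k : ℕ, N ≤ n → N ≤ k →
      eLpNorm (X n - X k) 2 μ < (2 * (C * (1 - r)⁻¹) + 1) * r ^ N := by
    intro N n k hn hk
    have hrN : r ^ N ≠ 0 := pow_ne_zero _ hr0
    have hrN' : r ^ N ≠ ∞ := ENNReal.pow_ne_top (hr1.trans ENNReal.one_lt_top).ne
    have : X n - X k = (X n - X N) - (X k - X N) := by abel
    rw [this]
    calc _ ≤ C * (1 - r)⁻¹ * r ^ N + C * (1 - r)⁻¹ * r ^ N :=
          (eLpNorm_sub_le ((hX _).sub (hX _)).1 ((hX _).sub (hX _)).1 (by norm_num)).trans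
            (add_le_add (htail N n hn) (htail N k hk))
      _ = 2 * (C * (1 - r)⁻¹) * r ^ N := by ring
      _ < _ := by
        refine (ENNReal.mul_lt_mul_iff_left hrN hrN').2 (ENNReal.lt_add_right ?_ one_ne_zero)
        exact ENNReal.mul_ne_top (by norm_num) (ENNReal.mul_ne_top hC hrt)
  have hB : ∑' N, (2 * (C * (1 - r)⁻¹) + 1) * r ^ N ≠ ∞ := by
    rw [ENNReal.tsum_mul_left, ENNReal.tsum_geometric]
    exact ENNReal.mul_ne_top (ENNReal.add_ne_top.2
      ⟨ENNReal.mul_ne_top (by norm_num) (ENNReal.mul_ne_top hC hrt), by norm_num⟩) hrt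
  obtain ⟨W, hW, hlim⟩ := exists_stronglyMeasurable_limit_of_tendsto_ae (fun n => (hX n).1)
    (Lp.ae_tendsto_of_cauchy_eLpNorm (fun n => (hX n).1) (by norm_num) hB hcau)
  have hL2 := Lp.cauchy_tendsto_of_tendsto (fun n => (hX n).1) W hB hcau hlim
  exact ⟨W, hW.measurable,
    Lp.memLp_of_cauchy_tendsto (by norm_num) hX W hW.aestronglyMeasurable hL2, hlim, hL2⟩

/-- The size of generation `n` divided by its mean. -/
noncomputable def normSize (m : ℝ) (n : ℕ) (N : List ℕ → ℕ) : ℝ :=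
  genSum n (fun _ => (1 : ℝ)) N / m ^ n

lemma genSum_const_one (n : ℕ) (N : List ℕ → ℕ) :
    genSum n (fun _ => (1 : ℝ)) N = (generation N n).card := by
  simp [genSum]

lemma normSize_nonneg {m : ℝ} (hm : 0 ≤ m) (n : ℕ) (N : List ℕ → ℕ) : 0 ≤ normSize m n N := by
  rw [normSize, genSum_const_one]
  positivity

lemma normSize_succ_sub {m : ℝ} (hm : 0 < m) (n : ℕ) :
    normSize m (n + 1) - normSize m n
      = (m ^ (n + 1))⁻¹ • genSum n (fun N => (N [] : ℝ) - m) := by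
  funext N
  have h1 : genSum (n + 1) (fun _ => (1 : ℝ)) N = genSum n (fun N => (N [] : ℝ)) N := by
    rw [genSum_succ', funext fun N => genSum_one (fun _ => (1 : ℝ)) N]
    simp
  have h2 : genSum n (fun N => (N [] : ℝ) - m) N
      = genSum n (fun N => (N [] : ℝ)) N - m * genSum n (fun _ => (1 : ℝ)) N := by
    simp [genSum, Finset.sum_sub_distrib, mul_comm]
  simp only [Pi.sub_apply, Pi.smul_apply, normSize, h1, h2, smul_eq_mul]
  field_simp
  ring

/-- The normalised generation sizes converge almost surely and in `L²`, as the squared `L²` norm of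
the `n`th increment is of order `m ^ (-n)`. -/
theorem exists_limit_normSize {q : PMF ℕ} {m : ℝ} (hm : 1 < m)
    (hmean : HasSum (fun n : ℕ => (n : ℝ) * (q n).toReal) m)
    (hvar : Summable (fun n : ℕ => (n : ℝ) ^ 2 * (q n).toReal)) :
    ∃ W : (List ℕ → ℕ) → ℝ, Measurable W ∧ MemLp W 2 (galtonWatson q) ∧
      (∀ᵐ N ∂galtonWatson q, Tendsto (fun n => normSize m n N) atTop (𝓝 (W N))) ∧
      ¬ W =ᵐ[galtonWatson q] 0 := by
  have hm0 : 0 < m := by linarith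
  have hM := lintegral_natCast_toMeasure hmean
  have hM' : ∫⁻ k : ℕ, (k : ℝ≥0∞) ∂q.toMeasure ≠ ∞ := hM ▸ ENNReal.ofReal_ne_top
  have hroot : MeasurePreserving (fun N : List ℕ → ℕ => N []) (galtonWatson q) q.toMeasure :=
    measurePreserving_eval_infinitePi (fun _ : List ℕ => q.toMeasure) []
  have hq2 : MemLp (fun k : ℕ => (k : ℝ)) 2 q.toMeasure := by
    refine (memLp_two_iff_integrable_sq (by fun_prop)).2 ⟨by fun_prop, ?_⟩
    rw [HasFiniteIntegral, lintegral_countable']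
    refine lt_of_eq_of_lt (tsum_congr fun n => ?_) hvar.tsum_ofReal_lt_top
    rw [PMF.toMeasure_apply_singleton _ _ (measurableSet_singleton n),
      ENNReal.ofReal_mul (by positivity), ENNReal.ofReal_toReal (q.apply_ne_top n),
      Real.enorm_of_nonneg (by positivity)]
  set h : (List ℕ → ℕ) → ℝ := fun N => (N [] : ℝ) - m with hdef
  have hh : Measurable h := by fun_prop
  have hr2 : MemLp (fun N : List ℕ → ℕ => (N [] : ℝ)) 2 (galtonWatson q) :=
    hq2.comp_measurePreserving hroot
  have h2 : MemLp h 2 (galtonWatson q) := hr2.sub (memLp_const m)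
  have h0 : ∫ N, h N ∂galtonWatson q = 0 := by
    rw [hdef, integral_sub (hr2.integrable (by norm_num)) (integrable_const m),
      integral_comp_measurePreserving hroot (g := fun k : ℕ => (k : ℝ)) (by fun_prop),
      integral_eq_lintegral_of_nonneg_ae (.of_forall fun k => by simp) (by fun_prop)]
    simp [hM, hm0.le]
  have hmem := memLp_genSum hh hM' h2 h0
  have hX : ∀ n, MemLp (normSize m n) 2 (galtonWatson q) := by
    intro n
    induction n with
    | zero =>
      have : normSize m 0 = fun _ => 1 := by
        funext N
        simp [normSize]
      rw [this]
      exact memLp_const 1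
    | succ n ih =>
      have := ih.add ((hmem n).1.const_smul (m ^ (n + 1))⁻¹)
      rwa [← normSize_succ_sub hm0, add_sub_cancel] at this
  set μ := galtonWatson q
  set S := ∫⁻ N, ‖h N‖ₑ ^ 2 ∂μ
  have hnorm : ∀ g : (List ℕ → ℕ) → ℝ, eLpNorm g 2 μ = (∫⁻ N, ‖g N‖ₑ ^ 2 ∂μ) ^ (1 / 2 : ℝ) := by
    intro g
    rw [eLpNorm_eq_lintegral_rpow_enorm_toReal (by norm_num) (by norm_num)]
    simp
  have hStop : S ≠ ∞ := by
    intro hS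
    have := h2.2
    rw [hnorm, show ∫⁻ N, ‖h N‖ₑ ^ 2 ∂μ = ∞ from hS] at this
    simp at this
  have hmE : ENNReal.ofReal m ≠ 0 := by simpa using hm0
  have hincr : ∀ n, eLpNorm (normSize m (n + 1) - normSize m n) 2 μ
      ≤ S ^ (1 / 2 : ℝ) * ((ENNReal.ofReal m)⁻¹ ^ (1 / 2 : ℝ)) ^ n := by
    intro n
    have hle : ∫⁻ N, ‖(normSize m (n + 1) - normSize m n) N‖ₑ ^ 2 ∂μ
        ≤ S * (ENNReal.ofReal m)⁻¹ ^ n := by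
      rw [normSize_succ_sub hm0]
      simp only [Pi.smul_apply, smul_eq_mul, enorm_mul, mul_pow]
      rw [lintegral_const_mul _ (by
        have := measurable_genSum hh n
        fun_prop), (hmem n).2.2, hM]
      have he : ‖(m ^ (n + 1))⁻¹‖ₑ = (ENNReal.ofReal m)⁻¹ ^ (n + 1) := by
        rw [Real.enorm_of_nonneg (by positivity), ENNReal.ofReal_inv_of_pos (by positivity),
          ENNReal.ofReal_pow hm0.le, ENNReal.inv_pow]
      have hcancel : (ENNReal.ofReal m)⁻¹ ^ n * ENNReal.ofReal m ^ n = 1 := by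
        rw [← mul_pow, ENNReal.inv_mul_cancel hmE ENNReal.ofReal_ne_top, one_pow]
      have hinv : (ENNReal.ofReal m)⁻¹ ≤ 1 := by
        rw [ENNReal.inv_le_one]
        exact ENNReal.one_le_ofReal.2 hm.le
      rw [he]
      calc ((ENNReal.ofReal m)⁻¹ ^ (n + 1)) ^ 2 * (ENNReal.ofReal m ^ n * S)
          = (ENNReal.ofReal m)⁻¹ ^ 2 * ((ENNReal.ofReal m)⁻¹ ^ n * ENNReal.ofReal m ^ n)
            * (S * (ENNReal.ofReal m)⁻¹ ^ n) := by ring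
        _ ≤ 1 * 1 * (S * (ENNReal.ofReal m)⁻¹ ^ n) := by
            rw [hcancel]
            gcongr
            exact pow_le_one₀ (zero_le) hinv
        _ = _ := by ring
    rw [hnorm]
    refine (ENNReal.rpow_le_rpow hle (by norm_num)).trans_eq ?_
    rw [ENNReal.mul_rpow_of_nonneg _ _ (by norm_num), ← ENNReal.rpow_natCast,
      ← ENNReal.rpow_natCast, ← ENNReal.rpow_mul, ← ENNReal.rpow_mul, mul_comm (n : ℝ)]
  obtain ⟨W, hW, hW2, hlim, hL2⟩ := exists_limit_of_eLpNorm_sub_le_geometric hX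
    (ENNReal.rpow_ne_top_of_nonneg (by norm_num) hStop)
    (by simp) (ENNReal.rpow_lt_one (by simpa using hm) (by norm_num)) hincr
  refine ⟨W, hW, hW2, hlim, fun hW0 => ?_⟩
  -- The mean of `normSize m n` is `1`, so its `L²` norm does not tend to `0`.
  have hone : ∀ n, 1 ≤ eLpNorm (normSize m n - W) 2 μ := by
    intro n
    have hae : normSize m n - W =ᵐ[μ] normSize m n := by
      filter_upwards [hW0] with N hN
      simp [hN]
    rw [eLpNorm_congr_ae hae]
    refine le_trans (le_of_eq ?_) (eLpNorm_le_eLpNorm_of_exponent_le (p := 1) (q := 2)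
      (by norm_num) (hX n).1)
    have hen : ∀ N, ‖normSize m n N‖ₑ
        = (ENNReal.ofReal m)⁻¹ ^ n * genSum n (fun _ => (1 : ℝ≥0∞)) N := by
      intro N
      rw [Real.enorm_of_nonneg (normSize_nonneg hm0.le n N), normSize, genSum_const_one,
        ENNReal.ofReal_div_of_pos (by positivity), ENNReal.ofReal_pow hm0.le,
        ENNReal.div_eq_inv_mul, ENNReal.inv_pow]
      simp [genSum]
    simp only [eLpNorm_one_eq_lintegral_enorm, hen]
    rw [lintegral_const_mul _ (measurable_genSum measurable_const n),
      lintegral_genSum measurable_const, hM, lintegral_one, measure_univ, mul_one, ← mul_pow,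
      ENNReal.inv_mul_cancel hmE ENNReal.ofReal_ne_top, one_pow]
  have := ge_of_tendsto' hL2 hone
  simp at this

/-! ### Positivity of the limit -/

lemma ae_forall_below {q : PMF ℕ} {P : (List ℕ → ℕ) → Prop} (h : ∀ᵐ N ∂galtonWatson q, P N) :
    ∀ᵐ N ∂galtonWatson q, ∀ v, P (below N v) :=
  ae_all_iff.2 fun v => (measurePreserving_below q v).quasiMeasurePreserving.ae h

lemma ae_pos_offspring {q : PMF ℕ} (hq0 : q 0 = 0) : ∀ᵐ N ∂galtonWatson q, ∀ v, 0 < N v := by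
  refine ae_all_iff.2 fun v => ?_
  refine (measurePreserving_eval_infinitePi (fun _ : List ℕ => q.toMeasure)
    v).quasiMeasurePreserving.ae (p := fun k => 0 < k) ?_
  rw [ae_iff]
  have : {k : ℕ | ¬ 0 < k} = {0} := by
    ext k
    simp
  rw [this, PMF.toMeasure_apply_singleton _ _ (measurableSet_singleton 0), hq0]

/-- If the normalised generation sizes of all subtrees converge, their limits are additive along
the tree. -/
lemma genSum_one_limit {m : ℝ} (hm : 0 < m) {W : (List ℕ → ℕ) → ℝ} {N : List ℕ → ℕ}
    (h : ∀ v, Tendsto (fun n => normSize m n (below N v)) atTop (𝓝 (W (below N v)))) :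
    genSum 1 W N = m * W N := by
  have h1 : Tendsto (fun n => m * normSize m (n + 1) N) atTop (𝓝 (m * W N)) :=
    ((h []).comp (tendsto_add_atTop_nat 1)).const_mul m
  have h2 : ∀ n, m * normSize m (n + 1) N = genSum 1 (normSize m n) N := by
    intro n
    rw [genSum_one, normSize, genSum_succ, genSum_one]
    simp only [normSize]
    rw [← Finset.sum_div]
    field_simp
    ring
  simp only [h2, genSum_one] at h1
  rw [genSum_one]
  exact tendsto_nhds_unique (tendsto_finsetSum _ fun i _ => h [i]) h1

/-- A property that passes from a tree to the subtrees of the children of the root has probability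
zero or one: the probability `s` satisfies `s ≤ a * s + (1 - a) * s ^ 2`, where `a < 1` is the
probability that the root has at most one child. -/
lemma measure_eq_zero_of_hereditary {q : PMF ℕ} (hq0 : q 0 = 0) (hq1 : q 1 ≠ 1)
    {B : Set (List ℕ → ℕ)} (hB : MeasurableSet B) (hlt : galtonWatson q B ≠ 1)
    (h : ∀ᵐ N ∂galtonWatson q, N ∈ B → ∀ i < N [], below N [i] ∈ B) :
    galtonWatson q B = 0 := by
  set s := galtonWatson q B with hs
  set P := Measure.infinitePi fun _ : ℕ => galtonWatson q
  -- Only the first two children are used, and only when they exist.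
  set E : Set (ℕ × (ℕ → List ℕ → ℕ)) :=
    {k : ℕ | k ≤ 1} ×ˢ (({0} : Finset ℕ) : Set ℕ).pi (fun _ => B) ∪
      {k : ℕ | k ≤ 1}ᶜ ×ˢ (({0, 1} : Finset ℕ) : Set ℕ).pi (fun _ => B) with hE
  have hEm : MeasurableSet E :=
    ((MeasurableSet.of_discrete).prod (.pi (Finset.countable_toSet _) fun _ _ => hB)).union
      ((MeasurableSet.of_discrete).prod (.pi (Finset.countable_toSet _) fun _ _ => hB))
  have hpi : ∀ t : Finset ℕ, P ((t : Set ℕ).pi fun _ => B) = s ^ t.card := fun t => by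
    rw [Measure.infinitePi_pi _ fun _ _ => hB, Finset.prod_const]
  have hle : s ≤ q.toMeasure {k | k ≤ 1} * s + q.toMeasure {k | k ≤ 1}ᶜ * s ^ 2 := by
    calc s ≤ galtonWatson q ((fun N : List ℕ → ℕ => (N [], fun i : ℕ => below N [i])) ⁻¹' E) := by
          refine measure_mono_ae ?_
          filter_upwards [h, ae_pos_offspring hq0] with N hN hpos hNB
          have hmem := hN hNB
          have h0 := hmem 0 (hpos [])
          by_cases hk : N [] ≤ 1
          · exact Or.inl ⟨hk, by simpa using h0⟩
          · refine Or.inr ⟨hk, ?_⟩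
            have h1 := hmem 1 (by omega)
            simpa using ⟨h0, h1⟩
      _ = (q.toMeasure.prod P) E :=
          (measurePreserving_split q).measure_preimage hEm.nullMeasurableSet
      _ ≤ _ := by
          refine (measure_union_le _ _).trans ?_
          rw [Measure.prod_prod, Measure.prod_prod, hpi, hpi]
          simp
  have hcompl : q.toMeasure {k | k ≤ 1}ᶜ = 1 - q 1 := by
    rw [prob_compl_eq_one_sub MeasurableSet.of_discrete]
    congr 1
    have : {k : ℕ | k ≤ 1} = {0} ∪ {1} := by
      ext k
      simp only [Set.mem_ofPred_eq, Set.mem_union, Set.mem_singleton_iff]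
      omega
    rw [this, measure_union (by simp) (measurableSet_singleton 1),
      PMF.toMeasure_apply_singleton _ _ (measurableSet_singleton 0),
      PMF.toMeasure_apply_singleton _ _ (measurableSet_singleton 1), hq0, zero_add]
  have hsum := prob_add_prob_compl (μ := q.toMeasure) (s := {k : ℕ | k ≤ 1})
    MeasurableSet.of_discrete
  have hb0 : q.toMeasure {k | k ≤ 1}ᶜ ≠ 0 := by
    rw [hcompl]
    exact (tsub_pos_of_lt (lt_of_le_of_ne (q.coe_le_one 1) hq1)).ne'
  have hs1 : s ≤ 1 := prob_le_one
  have ha : q.toMeasure {k | k ≤ 1} ≠ ∞ := measure_ne_top _ _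
  have hb : q.toMeasure {k | k ≤ 1}ᶜ ≠ ∞ := measure_ne_top _ _
  lift s to NNReal using measure_ne_top _ _ with s'
  lift q.toMeasure {k | k ≤ 1} to NNReal using ha with a
  lift q.toMeasure {k | k ≤ 1}ᶜ to NNReal using hb with b
  norm_cast at hle hsum hb0 hs1 hlt ⊢
  have hbpos : (0 : ℝ) < b := by exact_mod_cast pos_iff_ne_zero.2 hb0
  have hle' : (s' : ℝ) ≤ a * s' + b * s' ^ 2 := by exact_mod_cast hle
  have hsum' : (a : ℝ) + b = 1 := by exact_mod_cast hsum
  have hlt' : (s' : ℝ) < 1 := by exact_mod_cast lt_of_le_of_ne hs1 hlt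
  have hs0 : (0 : ℝ) ≤ s' := s'.2
  have : (s' : ℝ) = 0 := by
    by_contra hne
    have hpos : (0 : ℝ) < s' := lt_of_le_of_ne hs0 (Ne.symm hne)
    have : 0 < (b : ℝ) * s' * (1 - s') := by
      have : 0 < 1 - (s' : ℝ) := by linarith
      positivity
    nlinarith
  exact_mod_cast this

/-- The limit of the normalised generation sizes is almost surely positive, for all subtrees. -/
theorem ae_forall_limit_pos {q : PMF ℕ} {m : ℝ} (hm : 0 < m) (hq0 : q 0 = 0) (hq1 : q 1 ≠ 1)
    {W : (List ℕ → ℕ) → ℝ} (hW : Measurable W)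
    (hlim : ∀ᵐ N ∂galtonWatson q, Tendsto (fun n => normSize m n N) atTop (𝓝 (W N)))
    (hne : ¬ W =ᵐ[galtonWatson q] 0) :
    ∀ᵐ N ∂galtonWatson q, ∀ v, 0 < W (below N v) := by
  have hlim' := ae_forall_below hlim
  have hB : MeasurableSet {N | W N = 0} := hW (measurableSet_singleton 0)
  have hnn : ∀ᵐ N ∂galtonWatson q, 0 ≤ W N := by
    filter_upwards [hlim] with N hN
    exact ge_of_tendsto' hN fun n => normSize_nonneg hm.le n N
  have h0 : galtonWatson q {N | W N = 0} = 0 := by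
    refine measure_eq_zero_of_hereditary hq0 hq1 hB ?_ ?_
    · intro h1
      exact hne ((prob_compl_eq_zero_iff hB).2 h1)
    · filter_upwards [hlim', ae_forall_below hnn] with N hN hnnN hN0 i hi
      have hsum := genSum_one_limit hm hN
      rw [show W N = 0 from hN0, mul_zero, genSum_one,
        Finset.sum_eq_zero_iff_of_nonneg fun i _ => hnnN [i]] at hsum
      exact hsum i (Finset.mem_range.2 hi)
  refine ae_forall_below (P := fun N => 0 < W N) ?_
  filter_upwards [hnn, measure_eq_zero_iff_ae_notMem.1 h0] with N h1 h2
  exact lt_of_le_of_ne h1 (Ne.symm h2)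

/-! ### Sums of an integrable functional over generations -/

/-- The powers of `m` below `x` have a sum of order `x`, since the largest of them dominates. -/
lemma sum_range_pow_lt_le {m x : ℝ} (hm : 1 < m) (hx : 0 ≤ x) (K : ℕ) :
    ∑ n ∈ Finset.range K, (if m ^ n < x then m ^ n else 0) ≤ m / (m - 1) * x := by
  have hm1 : 0 < m - 1 := by linarith
  suffices h : ∑ n ∈ Finset.range K, (if m ^ n < x then m ^ n else 0) ≤ m ^ K / (m - 1) ∧
      ∑ n ∈ Finset.range K, (if m ^ n < x then m ^ n else 0) ≤ m / (m - 1) * x from h.2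
  induction K with
  | zero => exact ⟨by simp [hm.le], by simp; positivity⟩
  | succ K ih =>
    rw [Finset.sum_range_succ]
    have hstep : m ^ K / (m - 1) + m ^ K = m ^ (K + 1) / (m - 1) := by
      field_simp
      ring
    split_ifs with hK
    · have h1 : m ^ (K + 1) / (m - 1) ≤ m / (m - 1) * x := by
        rw [pow_succ, mul_comm, mul_div_right_comm]
        gcongr
      constructor <;> linarith [ih.1]
    · have h2 : 0 ≤ m ^ K := by positivity
      constructor <;> linarith [ih.1, ih.2]

/-- The terms `x ^ 2 / m ^ n` with `m ^ n ≥ x` have a sum of order `x`, since the first of them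
dominates. -/
lemma sum_range_sq_div_pow_le {m x : ℝ} (hm : 1 < m) (hx : 0 ≤ x) (K : ℕ) :
    ∑ n ∈ Finset.range K, (if x ≤ m ^ n then x ^ 2 / m ^ n else 0) ≤ m / (m - 1) * x := by
  have hm1 : 0 < m - 1 := by linarith
  set T := fun K => ∑ n ∈ Finset.range K, (if x ≤ m ^ n then x ^ 2 / m ^ n else 0) with hT
  -- The second alternative keeps track of the sum of all the remaining terms.
  have key : ∀ K, (m ^ K < x → T K = 0) ∧
      (x ≤ m ^ K → T K + m / (m - 1) * (x ^ 2 / m ^ K) ≤ m / (m - 1) * x) := by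
    have hfirst : ∀ K, x ≤ m ^ K → m / (m - 1) * (x ^ 2 / m ^ K) ≤ m / (m - 1) * x := by
      intro K hK
      gcongr
      rw [div_le_iff₀ (by positivity), sq]
      gcongr
    intro K
    induction K with
    | zero => exact ⟨fun _ => by simp [T], fun h => by simpa [T] using hfirst 0 h⟩
    | succ K ih =>
      have hmono : m ^ K ≤ m ^ (K + 1) := pow_le_pow_right₀ hm.le (Nat.le_succ K)
      have hsucc : T (K + 1) = T K + if x ≤ m ^ K then x ^ 2 / m ^ K else 0 :=
        Finset.sum_range_succ _ _
      rcases lt_or_ge (m ^ K) x with hK | hK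
      · rw [hsucc, if_neg hK.not_ge, ih.1 hK]
        exact ⟨fun _ => by simp, fun h => by simpa using hfirst _ h⟩
      · refine ⟨fun h => absurd h (hK.trans hmono).not_gt, fun _ => ?_⟩
        rw [hsucc, if_pos hK]
        refine le_trans (le_of_eq ?_) (ih.2 hK)
        rw [pow_succ]
        field_simp
        ring
  rcases lt_or_ge (m ^ K) x with hK | hK
  · change T K ≤ _
    rw [(key K).1 hK]
    positivity
  · have : 0 ≤ m / (m - 1) * (x ^ 2 / m ^ K) := by positivity
    change T K ≤ _
    linarith [(key K).2 hK]

lemma tsum_ofReal_le_of_sum_range_le {a : ℕ → ℝ} (ha : ∀ n, 0 ≤ a n) {c : ℝ}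
    (h : ∀ K, ∑ n ∈ Finset.range K, a n ≤ c) : ∑' n, ENNReal.ofReal (a n) ≤ ENNReal.ofReal c := by
  refine ENNReal.tsum_le_of_sum_range_le fun K => ?_
  rw [← ENNReal.ofReal_sum_of_nonneg fun n _ => ha n]
  exact ENNReal.ofReal_le_ofReal (h K)

lemma lintegral_sq_sub_integral_le {Ω : Type*} [MeasurableSpace Ω] {μ : Measure Ω}
    [IsProbabilityMeasure μ] {X : Ω → ℝ} (hX : MemLp X 2 μ) :
    ∫⁻ x, ‖X x - ∫ y, X y ∂μ‖ₑ ^ 2 ∂μ ≤ ∫⁻ x, ENNReal.ofReal (X x ^ 2) ∂μ := by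
  calc ∫⁻ x, ‖X x - ∫ y, X y ∂μ‖ₑ ^ 2 ∂μ = ENNReal.ofReal (ProbabilityTheory.variance X μ) :=
        hX.ofReal_variance_eq.symm
    _ ≤ ENNReal.ofReal (∫ x, X x ^ 2 ∂μ) :=
        ENNReal.ofReal_le_ofReal (ProbabilityTheory.variance_le_expectation_sq hX.1)
    _ = _ := ofReal_integral_eq_lintegral_ofReal hX.integrable_sq (.of_forall fun x => sq_nonneg _)

/-- Almost surely, only finitely many vertices `v` have a value `X (below N v)` larger than
`m ^ |v|`, when `X` is integrable. -/
lemma ae_eventually_le_pow {q : PMF ℕ} {m : ℝ} (hm : 1 < m)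
    (hM : ∫⁻ k : ℕ, (k : ℝ≥0∞) ∂q.toMeasure = ENNReal.ofReal m)
    {X : (List ℕ → ℕ) → ℝ} (hX : Measurable X) (hX0 : ∀ N, 0 ≤ X N)
    (hXi : Integrable X (galtonWatson q)) :
    ∀ᵐ N ∂galtonWatson q, ∀ᶠ n in atTop, ∀ v ∈ generation N n, X (below N v) ≤ m ^ n := by
  have hm0 : 0 < m := by linarith
  have hset : ∀ n : ℕ, MeasurableSet {N | m ^ n < X N} := fun n =>
    measurableSet_lt measurable_const hX
  have hmeas : ∀ n : ℕ, Measurable ({N | m ^ n < X N}.indicator fun _ => (1 : ℝ≥0∞)) :=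
    fun n => measurable_const.indicator (hset n)
  have hfin : ∫⁻ N, ∑' n, genSum n ({N | m ^ n < X N}.indicator fun _ => (1 : ℝ≥0∞)) N
      ∂galtonWatson q ≠ ∞ := by
    rw [lintegral_tsum fun n => (measurable_genSum (hmeas n) n).aemeasurable]
    simp only [fun n => lintegral_genSum (q := q) (hmeas n) n, hM]
    simp only [fun n => (lintegral_const_mul (μ := galtonWatson q)
      (ENNReal.ofReal m ^ n) (hmeas n)).symm]
    rw [← lintegral_tsum fun n => ((hmeas n).const_mul _).aemeasurable]
    refine ne_top_of_le_ne_top ?_ (lintegral_mono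
      (g := fun N => ENNReal.ofReal (m / (m - 1) * X N)) fun N => ?_)
    · exact (hXi.const_mul (m / (m - 1))).lintegral_lt_top.ne
    · refine le_trans (le_of_eq (tsum_congr fun n => ?_)) (tsum_ofReal_le_of_sum_range_le
        (fun n => ?_) (sum_range_pow_lt_le hm (hX0 N)))
      · by_cases h : m ^ n < X N <;> simp [h, ENNReal.ofReal_pow hm0.le]
      · split_ifs <;> positivity
  have hmeas' : Measurable fun N => ∑' n,
      genSum n ({N | m ^ n < X N}.indicator fun _ => (1 : ℝ≥0∞)) N :=
    Measurable.tsum fun n => measurable_genSum (hmeas n) n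
  filter_upwards [ae_lt_top hmeas' hfin] with N hN
  filter_upwards [(ENNReal.tendsto_atTop_zero_of_tsum_ne_top hN.ne).eventually_lt_const
    one_pos] with n hn v hv
  by_contra! hlt
  refine hn.not_ge ?_
  have := Finset.single_le_sum_of_canonicallyOrdered (f := fun v =>
    {N | m ^ n < X N}.indicator (fun _ => (1 : ℝ≥0∞)) (below N v)) hv
  rw [genSum]
  refine le_trans (le_of_eq ?_) this
  simp [hlt]

/-- For an integrable functional `X ≥ 0` of trees, the sums of `X` over the generations are almost
surely at most of the order of the expected generation sizes. With `X` truncated at level `m ^ n` in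
generation `n`, the normalised sums differ from their means by terms whose second moments are
summable, and the truncation matters in finitely many generations only. -/
theorem ae_exists_genSum_le {q : PMF ℕ} {m : ℝ} (hm : 1 < m)
    (hM : ∫⁻ k : ℕ, (k : ℝ≥0∞) ∂q.toMeasure = ENNReal.ofReal m)
    (hbdd : ∀ᵐ N ∂galtonWatson q, ∃ C, ∀ n, normSize m n N ≤ C)
    {X : (List ℕ → ℕ) → ℝ} (hX : Measurable X) (hX0 : ∀ N, 0 ≤ X N)
    (hXi : Integrable X (galtonWatson q)) :
    ∀ᵐ N ∂galtonWatson q, ∃ C, ∀ n, genSum n X N ≤ C * m ^ n := by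
  have hm0 : 0 < m := by linarith
  set μ := galtonWatson q
  set Y : ℕ → (List ℕ → ℕ) → ℝ := fun n => {N | X N ≤ m ^ n}.indicator X with hY
  have hYm : ∀ n, Measurable (Y n) := fun n => hX.indicator (measurableSet_le hX measurable_const)
  have hY0 : ∀ n N, 0 ≤ Y n N := fun n N => Set.indicator_nonneg (fun N _ => hX0 N) N
  have hYX : ∀ n N, Y n N ≤ X N := fun n N => Set.indicator_le_self' (fun N _ => hX0 N) N
  have hY2 : ∀ n, MemLp (Y n) 2 μ := fun n => by
    refine MemLp.of_bound (hYm n).aestronglyMeasurable (m ^ n) (.of_forall fun N => ?_)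
    rw [Real.norm_of_nonneg (hY0 n N)]
    by_cases h : X N ≤ m ^ n
    · simp [Y, h]
    · simp [Y, h, hm0.le]
  have hYi : ∀ n, Integrable (Y n) μ := fun n => (hY2 n).integrable (by norm_num)
  have hYe : ∀ n, ∫ N, Y n N ∂μ ≤ ∫ N, X N ∂μ := fun n => integral_mono (hYi n) hXi (hYX n)
  set h : ℕ → (List ℕ → ℕ) → ℝ := fun n N => Y n N - ∫ N, Y n N ∂μ with hh
  have hhm : ∀ n, Measurable (h n) := fun n => (hYm n).sub_const _
  have hh2 : ∀ n, MemLp (h n) 2 μ := fun n => (hY2 n).sub (memLp_const _)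
  have hh0 : ∀ n, ∫ N, h n N ∂μ = 0 := fun n => by
    rw [hh, integral_sub (hYi n) (integrable_const _)]
    simp
  have hMt : ∫⁻ k : ℕ, (k : ℝ≥0∞) ∂q.toMeasure ≠ ∞ := hM ▸ ENNReal.ofReal_ne_top
  have hDm : ∀ n, Measurable fun N => ‖(m ^ n)⁻¹ * genSum n (h n) N‖ₑ ^ 2 := fun n => by
    have := measurable_genSum (hhm n) n
    fun_prop
  have hterm : ∀ n, ∫⁻ N, ‖(m ^ n)⁻¹ * genSum n (h n) N‖ₑ ^ 2 ∂μ
      ≤ ∫⁻ N, ENNReal.ofReal (if X N ≤ m ^ n then X N ^ 2 / m ^ n else 0) ∂μ := by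
    intro n
    have hgm := measurable_genSum (hhm n) n
    have he : ‖(m ^ n)⁻¹‖ₑ ^ 2 * ENNReal.ofReal m ^ n = ENNReal.ofReal (m ^ n)⁻¹ := by
      rw [Real.enorm_of_nonneg (by positivity), ← ENNReal.ofReal_pow (by positivity),
        ← ENNReal.ofReal_pow hm0.le, ← ENNReal.ofReal_mul (by positivity)]
      congr 1
      field_simp
    calc ∫⁻ N, ‖(m ^ n)⁻¹ * genSum n (h n) N‖ₑ ^ 2 ∂μ
        = ENNReal.ofReal (m ^ n)⁻¹ * ∫⁻ N, ‖h n N‖ₑ ^ 2 ∂μ := by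
          simp only [enorm_mul, mul_pow]
          rw [lintegral_const_mul _ (by fun_prop), (memLp_genSum (hhm n) hMt (hh2 n) (hh0 n) n).2.2,
            hM, ← mul_assoc, he]
      _ ≤ ENNReal.ofReal (m ^ n)⁻¹ * ∫⁻ N, ENNReal.ofReal (Y n N ^ 2) ∂μ := by
          exact mul_le_mul' le_rfl (lintegral_sq_sub_integral_le (hY2 n))
      _ = _ := by
          have := hYm n
          rw [← lintegral_const_mul _ (by fun_prop)]
          refine lintegral_congr fun N => ?_
          rw [← ENNReal.ofReal_mul (by positivity)]
          by_cases hle : X N ≤ m ^ n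
          · simp [Y, hle, div_eq_inv_mul]
          · simp [Y, hle]
  have hfin : ∫⁻ N, ∑' n, ‖(m ^ n)⁻¹ * genSum n (h n) N‖ₑ ^ 2 ∂μ ≠ ∞ := by
    have hmm : ∀ n : ℕ, Measurable fun N =>
        ENNReal.ofReal (if X N ≤ m ^ n then X N ^ 2 / m ^ n else 0) := fun n =>
      (Measurable.ite (measurableSet_le hX measurable_const) (by fun_prop)
        measurable_const).ennreal_ofReal
    rw [lintegral_tsum fun n => (hDm n).aemeasurable]
    refine ne_top_of_le_ne_top ?_ (ENNReal.tsum_le_tsum hterm)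
    rw [← lintegral_tsum fun n => (hmm n).aemeasurable]
    refine ne_top_of_le_ne_top ?_ (lintegral_mono
      (g := fun N => ENNReal.ofReal (m / (m - 1) * X N)) fun N => ?_)
    · exact (hXi.const_mul (m / (m - 1))).lintegral_lt_top.ne
    · refine tsum_ofReal_le_of_sum_range_le (fun n => ?_) (sum_range_sq_div_pow_le hm (hX0 N))
      split_ifs <;> positivity
  filter_upwards [ae_lt_top (Measurable.tsum hDm) hfin,
    ae_eventually_le_pow hm hM hX hX0 hXi, hbdd] with N hN hev ⟨C, hC⟩
  have hev1 := (ENNReal.tendsto_atTop_zero_of_tsum_ne_top hN.ne).eventually_lt_const one_pos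
  have hbound : ∀ᶠ n in atTop, genSum n X N / m ^ n ≤ 1 + (∫ N, X N ∂μ) * C := by
    filter_upwards [hev, hev1] with n hn hn1
    have heq : genSum n X N
        = genSum n (h n) N + (∫ N, Y n N ∂μ) * genSum n (fun _ => (1 : ℝ)) N := by
      simp only [genSum, hh, Finset.sum_sub_distrib, Finset.sum_const]
      rw [Finset.sum_congr rfl fun v hv =>
        show X (below N v) = Y n (below N v) by simp [Y, hn v hv]]
      simp [mul_comm]
    have hle1 : (m ^ n)⁻¹ * genSum n (h n) N ≤ 1 := by
      have : ‖(m ^ n)⁻¹ * genSum n (h n) N‖ₑ < 1 := by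
        by_contra! hge
        exact hn1.not_ge (one_le_pow₀ hge)
      rw [← ofReal_norm, ENNReal.ofReal_lt_one] at this
      exact (Real.le_norm_self _).trans this.le
    have hC' := hC n
    rw [normSize] at hC'
    have h0n := normSize_nonneg hm0.le n N
    rw [normSize] at h0n
    calc genSum n X N / m ^ n = (m ^ n)⁻¹ * genSum n (h n) N
          + (∫ N, Y n N ∂μ) * (genSum n (fun _ => (1 : ℝ)) N / m ^ n) := by
          rw [heq]
          field_simp
      _ ≤ 1 + (∫ N, X N ∂μ) * C :=
          add_le_add hle1 (mul_le_mul (hYe n) hC' h0n (integral_nonneg hX0))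
  obtain ⟨B, hB⟩ := (Filter.isBoundedUnder_of_eventually_le hbound).bddAbove_range
  refine ⟨B, fun n => ?_⟩
  exact (div_le_iff₀ (by positivity)).1 (hB ⟨n, rfl⟩)

/-! ### The energy of a flow -/

lemma length_vertexAt (x : ℕ → ℕ) (n : ℕ) : (vertexAt x n).length = n := by
  simp [vertexAt]

lemma vertexAt_eq_iff {x y : ℕ → ℕ} {n : ℕ} : vertexAt x n = vertexAt y n ↔ ∀ i < n, x i = y i := by
  simp [vertexAt, List.map_inj_left]

lemma vertexAt_succ (x : ℕ → ℕ) (n : ℕ) : vertexAt x (n + 1) = vertexAt x n ++ [x n] := by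
  simp [vertexAt, List.range_succ]

lemma le_meetLevel_iff {x y : ℕ → ℕ} {n : ℕ} :
    (n : ℕ∞) ≤ WordTree.meetLevel x y ↔ vertexAt x n = vertexAt y n := by
  refine ⟨fun h => ?_, fun h => le_iSup₂_of_le n h le_rfl⟩
  by_contra hne
  cases n with
  | zero => exact hne rfl
  | succ n =>
    have hle : WordTree.meetLevel x y ≤ n := by
      refine iSup₂_le fun k hk => ?_
      have : k ≤ n := by
        by_contra! hlt
        exact hne (vertexAt_eq_iff.2 fun i hi => vertexAt_eq_iff.1 hk i (by omega))
      exact_mod_cast this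
    have := h.trans hle
    norm_cast at this
    omega

/-- A gauge written as a sum over levels of its increments. -/
lemma gaugeExt_eq_tsum {f : ℕ → ℝ} (hf : IsIncreasingGauge f) (l : ℕ∞) :
    gaugeExt f l = ENNReal.ofReal (f 0)
      + ∑' n : ℕ, if ((n + 1 : ℕ) : ℕ∞) ≤ l then ENNReal.ofReal (f (n + 1) - f n) else 0 := by
  have hsum : ∀ k, ENNReal.ofReal (f 0) + ∑ n ∈ Finset.range k, ENNReal.ofReal (f (n + 1) - f n)
      = ENNReal.ofReal (f k) := by
    intro k
    rw [← ENNReal.ofReal_sum_of_nonneg fun n _ => sub_nonneg.2 (hf.mono n.le_succ),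
      Finset.sum_range_sub, ← ENNReal.ofReal_add (hf.pos 0).le
      (sub_nonneg.2 (hf.mono (Nat.zero_le k)))]
    congr 1
    ring
  induction l using ENat.recTopCoe with
  | top =>
    simp only [le_top, if_true]
    rw [ENNReal.tsum_eq_iSup_nat, ENNReal.add_iSup]
    simp only [hsum]
    rfl
  | coe k =>
    rw [tsum_eq_sum (s := Finset.range k) fun n hn => if_neg (by
      rw [Finset.mem_range] at hn
      norm_cast)]
    rw [Finset.sum_congr rfl fun n hn => if_pos (by
      rw [Finset.mem_range] at hn
      norm_cast)]
    exact (hsum k).symm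

/-- The paths in the boundary of a tree that pass through the vertex `v`. -/
def pathsThrough (Γ : WordTree) (v : List ℕ) : Set Γ.boundary :=
  {x | vertexAt x v.length = v}

lemma measurableSet_pathsThrough (Γ : WordTree) (v : List ℕ) :
    MeasurableSet (pathsThrough Γ v) := by
  have h : pathsThrough Γ v
      = ⋂ i, ⋂ (hi : i < v.length), {x : Γ.boundary | (x : ℕ → ℕ) i = v[i]} := by
    ext x
    simp only [pathsThrough, Set.mem_ofPred_eq, Set.mem_iInter]
    constructor
    · intro hx i hi
      conv_rhs => rw [List.getElem_of_eq hx.symm hi]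
      simp [vertexAt]
    · intro hx
      refine List.ext_getElem (length_vertexAt _ _) fun i h1 h2 => ?_
      rw [← hx i h2]
      simp [vertexAt]
  rw [h]
  refine MeasurableSet.iInter fun i => MeasurableSet.iInter fun hi => ?_
  exact ((measurable_pi_apply i).comp measurable_subtype_coe) (measurableSet_singleton _)

section energy

variable {N : List ℕ → ℕ}

lemma mem_pathsThrough_iff {x : (familyTree N).boundary} {n : ℕ} {v : List ℕ}
    (hv : v ∈ generation N n) : x ∈ pathsThrough (familyTree N) v ↔ vertexAt x n = v := by
  rw [pathsThrough, Set.mem_ofPred_eq, (mem_generation.1 hv).1]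

lemma vertexAt_mem_generation (x : (familyTree N).boundary) (n : ℕ) :
    vertexAt x n ∈ generation N n :=
  mem_generation.2 ⟨length_vertexAt _ _, x.2 n⟩

lemma sum_generation_indicator (x : (familyTree N).boundary) (n : ℕ) (g : List ℕ → ℝ≥0∞) :
    ∑ v ∈ generation N n, (pathsThrough (familyTree N) v).indicator (fun _ => g v) x
      = g (vertexAt x n) := by
  rw [Finset.sum_eq_single_of_mem _ (vertexAt_mem_generation x n)]
  · rw [Set.indicator_of_mem]
    exact (mem_pathsThrough_iff (vertexAt_mem_generation x n)).2 rfl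
  · intro v hv hne
    rw [Set.indicator_of_notMem]
    rw [mem_pathsThrough_iff hv]
    exact Ne.symm hne

lemma sum_measure_pathsThrough (θ : Measure (familyTree N).boundary) [IsProbabilityMeasure θ]
    (n : ℕ) : ∑ v ∈ generation N n, θ (pathsThrough (familyTree N) v) = 1 := by
  have h : ∫⁻ x, ∑ v ∈ generation N n,
      (pathsThrough (familyTree N) v).indicator (fun _ => (1 : ℝ≥0∞)) x ∂θ = 1 := by
    simp [sum_generation_indicator]
  rw [lintegral_finsetSum _ fun v _ => measurable_const.indicator
    (measurableSet_pathsThrough _ v)] at h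
  simpa [lintegral_indicator, measurableSet_pathsThrough] using h

/-- Summation by parts for the energy: level `n + 1` contributes the increment of the gauge times
the probability that two independent paths share their vertex at that level. -/
theorem energy_eq_tsum {f : ℕ → ℝ} (hf : IsIncreasingGauge f)
    (θ : Measure (familyTree N).boundary) [IsProbabilityMeasure θ] :
    WordTree.energy (fun x y => gaugeExt f (WordTree.meetLevel x y)) θ
      = ENNReal.ofReal (f 0) + ∑' n, ENNReal.ofReal (f (n + 1) - f n)
          * ∑ v ∈ generation N (n + 1), θ (pathsThrough (familyTree N) v) ^ 2 := by
  have hms := measurableSet_pathsThrough (familyTree N)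
  have hK : ∀ x y : (familyTree N).boundary, gaugeExt f (WordTree.meetLevel x y)
      = ENNReal.ofReal (f 0) + ∑' n, ENNReal.ofReal (f (n + 1) - f n)
        * ∑ v ∈ generation N (n + 1), (pathsThrough (familyTree N) v).indicator
          (fun _ => (pathsThrough (familyTree N) v).indicator (fun _ => (1 : ℝ≥0∞)) y) x := by
    intro x y
    rw [gaugeExt_eq_tsum hf]
    congr 1
    refine tsum_congr fun n => ?_
    rw [sum_generation_indicator x (n + 1) fun v =>
      (pathsThrough (familyTree N) v).indicator (fun _ => (1 : ℝ≥0∞)) y]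
    have hmem := mem_pathsThrough_iff (x := y) (vertexAt_mem_generation x (n + 1))
    by_cases h : vertexAt (x : ℕ → ℕ) (n + 1) = vertexAt y (n + 1)
    · rw [if_pos (le_meetLevel_iff.2 h), Set.indicator_of_mem (hmem.2 h.symm), mul_one]
    · rw [if_neg (mt le_meetLevel_iff.1 h), Set.indicator_of_notMem (mt hmem.1 (Ne.symm h)),
        mul_zero]
  have hmeas1 : ∀ (y : (familyTree N).boundary) (n : ℕ), Measurable fun x =>
      ENNReal.ofReal (f (n + 1) - f n) * ∑ v ∈ generation N (n + 1),
        (pathsThrough (familyTree N) v).indicator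
          (fun _ => (pathsThrough (familyTree N) v).indicator (fun _ => (1 : ℝ≥0∞)) y) x :=
    fun y n => (Finset.measurable_sum _ fun v _ => measurable_const.indicator (hms v)).const_mul _
  have hmeas2 : ∀ n : ℕ, Measurable fun y =>
      ENNReal.ofReal (f (n + 1) - f n) * ∑ v ∈ generation N (n + 1),
        (pathsThrough (familyTree N) v).indicator (fun _ => (1 : ℝ≥0∞)) y
          * θ (pathsThrough (familyTree N) v) :=
    fun n => (Finset.measurable_sum _ fun v _ =>
      (measurable_const.indicator (hms v)).mul_const _).const_mul _
  have hinner : ∀ y : (familyTree N).boundary,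
      ∫⁻ x, gaugeExt f (WordTree.meetLevel x y) ∂θ
        = ENNReal.ofReal (f 0) + ∑' n, ENNReal.ofReal (f (n + 1) - f n)
        * ∑ v ∈ generation N (n + 1), (pathsThrough (familyTree N) v).indicator
          (fun _ => (1 : ℝ≥0∞)) y * θ (pathsThrough (familyTree N) v) := by
    intro y
    simp only [hK]
    rw [lintegral_add_left measurable_const, lintegral_const, measure_univ, mul_one,
      lintegral_tsum fun n => (hmeas1 y n).aemeasurable]
    congr 1
    refine tsum_congr fun n => ?_
    rw [lintegral_const_mul _ (Finset.measurable_sum _ fun v _ =>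
        measurable_const.indicator (hms v)),
      lintegral_finsetSum _ fun v _ => measurable_const.indicator (hms v)]
    simp only [lintegral_indicator_const (hms _)]
  rw [WordTree.energy]
  simp only [hinner]
  rw [lintegral_add_left measurable_const, lintegral_const, measure_univ, mul_one,
    lintegral_tsum fun n => (hmeas2 n).aemeasurable]
  congr 1
  refine tsum_congr fun n => ?_
  rw [lintegral_const_mul _ (Finset.measurable_sum _ fun v _ =>
      (measurable_const.indicator (hms v)).mul_const _),
    lintegral_finsetSum _ fun v _ => (measurable_const.indicator (hms v)).mul_const _]
  simp only [lintegral_mul_const _ (measurable_const.indicator (hms _)),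
    lintegral_indicator_const (hms _), one_mul, sq]

/-- By Cauchy–Schwarz, two independent paths share their vertex at level `n` with probability at
least the reciprocal of the size of generation `n`. -/
lemma inv_card_generation_le (θ : Measure (familyTree N).boundary) [IsProbabilityMeasure θ]
    (n : ℕ) : ((generation N n).card : ℝ≥0∞)⁻¹
      ≤ ∑ v ∈ generation N n, θ (pathsThrough (familyTree N) v) ^ 2 := by
  set a : List ℕ → NNReal := fun v => (θ (pathsThrough (familyTree N) v)).toNNReal with ha
  have hco : ∀ v, θ (pathsThrough (familyTree N) v) = a v := fun v =>
    (ENNReal.coe_toNNReal (measure_ne_top _ _)).symm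
  have h1 : ∑ v ∈ generation N n, a v = 1 := by
    have := sum_measure_pathsThrough θ n
    simp only [hco] at this
    exact_mod_cast this
  have h2 := sq_sum_le_card_mul_sum_sq (s := generation N n) (f := a)
  rw [h1, one_pow] at h2
  simp only [hco]
  rw [← one_div]
  refine ENNReal.div_le_of_le_mul' ?_
  exact_mod_cast h2

end energy

lemma cap_pos_iff {Γ : WordTree} {f : ℕ → ℝ} :
    0 < Γ.cap f ↔ ∃ θ : ProbabilityMeasure Γ.boundary,
      WordTree.energy (fun x y => gaugeExt f (WordTree.meetLevel x y)) (θ : Measure Γ.boundary)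
        ≠ ∞ := by
  simp [WordTree.cap, WordTree.kernelCap, ENNReal.inv_pos]

/-! ### Summability of the gauge and of its increments -/

/-- Summation by parts: a gauge is summable against the weights `m ^ (-n)` if and only if its
increments are. -/
lemma summable_gauge_iff {m : ℝ} (hm : 1 < m) {f : ℕ → ℝ} (hf : IsIncreasingGauge f) :
    Summable (fun n : ℕ => (m ^ (n + 1))⁻¹ * f (n + 1))
      ↔ ∑' n, ENNReal.ofReal (f (n + 1) - f n) * ENNReal.ofReal (m ^ (n + 1))⁻¹ ≠ ∞ := by
  have hm0 : 0 < m := by linarith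
  have hd : ∀ n, 0 ≤ f (n + 1) - f n := fun n => sub_nonneg.2 (hf.mono n.le_succ)
  have hd' : ∀ n, 0 ≤ (m ^ (n + 1))⁻¹ * (f (n + 1) - f n) := fun n =>
    mul_nonneg (by positivity) (hd n)
  have hiff : ∑' n, ENNReal.ofReal (f (n + 1) - f n) * ENNReal.ofReal (m ^ (n + 1))⁻¹ ≠ ∞
      ↔ Summable fun n : ℕ => (m ^ (n + 1))⁻¹ * (f (n + 1) - f n) := by
    have heq : ∀ n, ENNReal.ofReal (f (n + 1) - f n) * ENNReal.ofReal (m ^ (n + 1))⁻¹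
        = ENNReal.ofReal ((m ^ (n + 1))⁻¹ * (f (n + 1) - f n)) := fun n => by
      rw [← ENNReal.ofReal_mul (hd n), mul_comm]
    simp only [heq]
    refine ⟨fun h => ?_, fun h => h.tsum_ofReal_ne_top⟩
    exact (ENNReal.summable_toReal h).congr fun n => ENNReal.toReal_ofReal (hd' n)
  rw [hiff]
  constructor
  · intro h
    refine h.of_nonneg_of_le hd' fun n => ?_
    have := (hf.pos n).le
    gcongr
    linarith
  · intro h
    set D := ∑' n, (m ^ (n + 1))⁻¹ * (f (n + 1) - f n)
    have hA0 : ∀ n, 0 ≤ (m ^ (n + 1))⁻¹ * f (n + 1) := fun n =>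
      mul_nonneg (by positivity) (hf.pos _).le
    refine summable_of_sum_range_le (c := (f 0 + m * D) / (m - 1)) hA0 fun K => ?_
    -- Shifting the index turns `m` times the sum into the sum itself plus the one over increments.
    have key : m * ∑ n ∈ Finset.range K, (m ^ (n + 1))⁻¹ * f (n + 1) + (m ^ K)⁻¹ * f K
        = f 0 + ∑ n ∈ Finset.range K, (m ^ (n + 1))⁻¹ * f (n + 1)
          + m * ∑ n ∈ Finset.range K, (m ^ (n + 1))⁻¹ * (f (n + 1) - f n) := by
      induction K with
      | zero => simp
      | succ K ih =>
        simp only [Finset.sum_range_succ, mul_add]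
        have : m * ((m ^ (K + 1))⁻¹ * (f (K + 1) - f K)) = (m ^ K)⁻¹ * (f (K + 1) - f K) := by
          field_simp
          ring
        have : m * ((m ^ (K + 1))⁻¹ * f (K + 1)) = (m ^ K)⁻¹ * f (K + 1) := by
          field_simp
          ring
        linarith
    have hD := h.sum_le_tsum (Finset.range K) fun n _ => hd' n
    have hfK : 0 ≤ (m ^ K)⁻¹ * f K := mul_nonneg (by positivity) (hf.pos K).le
    rw [le_div_iff₀ (by linarith)]
    nlinarith [mul_le_mul_of_nonneg_left hD hm0.le]

/-! ### The flow of an additive function on the vertices -/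

section flow

variable {N : List ℕ → ℕ}

/-- The vertex reached after `n` steps from the root when at every vertex `v` the path continues
to the child number `c v`. -/
def walkVertex (c : ∀ v, Fin (N v)) : ℕ → List ℕ
  | 0 => []
  | n + 1 => walkVertex c n ++ [(c (walkVertex c n) : ℕ)]

/-- The path in the boundary obtained by following the choices `c` of a child at every vertex. -/
def walkPath (c : ∀ v, Fin (N v)) : (familyTree N).boundary :=
  ⟨fun n => c (walkVertex c n), fun n => by
    induction n with
    | zero => exact (familyTree N).root_mem
    | succ n ih =>
      have h : vertexAt (fun n => (c (walkVertex c n) : ℕ)) n = walkVertex c n := by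
        clear ih
        induction n with
        | zero => rfl
        | succ n ih => rw [vertexAt_succ, ih, walkVertex]
      rw [vertexAt_succ]
      exact append_singleton_mem_verts_familyTree.2 ⟨ih, h ▸ (c (walkVertex c n)).2⟩⟩

lemma vertexAt_walkPath (c : ∀ v, Fin (N v)) (n : ℕ) :
    vertexAt (walkPath c) n = walkVertex c n := by
  induction n with
  | zero => rfl
  | succ n ih => rw [vertexAt_succ, ih, walkVertex]; rfl

/-- The choices whose path passes through a given vertex form a box: they are prescribed at the
proper ancestors of the vertex. -/
lemma exists_walkVertex_eq_pi {v : List ℕ} (hv : v ∈ (familyTree N).verts)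
    (p : ∀ v, Measure (Fin (N v))) {F : List ℕ → ℝ≥0∞} (hF0 : F [] = 1)
    (hF : ∀ v (i : Fin (N v)), F (v ++ [(i : ℕ)]) = F v * p v {i}) :
    ∃ (s : Finset (List ℕ)) (c₀ : ∀ v, Set (Fin (N v))), (∀ u ∈ s, u.length < v.length) ∧
      {c : ∀ v, Fin (N v) | walkVertex c v.length = v} = (s : Set (List ℕ)).pi c₀ ∧
      ∏ u ∈ s, p u (c₀ u) = F v := by
  classical
  induction v using List.reverseRecOn with
  | nil => exact ⟨∅, fun _ => ∅, by simp, by ext c; simp [walkVertex], by simp [hF0]⟩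
  | append_singleton v i ih =>
    obtain ⟨hv', hi⟩ := append_singleton_mem_verts_familyTree.1 hv
    obtain ⟨s, c₀, hs, hpi, hprod⟩ := ih hv'
    have hvs : v ∉ s := fun h => lt_irrefl _ (hs v h)
    have hne : ∀ u ∈ s, u ≠ v := fun u hu => ne_of_mem_of_not_mem hu hvs
    refine ⟨insert v s, Function.update c₀ v {⟨i, hi⟩}, ?_, ?_, ?_⟩
    · intro u hu
      rcases Finset.mem_insert.1 hu with rfl | hu
      · simp
      · have := hs u hu
        simp only [List.length_append, List.length_singleton]
        omega
    · have hpi' : (s : Set (List ℕ)).pi (Function.update c₀ v {⟨i, hi⟩})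
          = (s : Set (List ℕ)).pi c₀ :=
        Set.pi_congr rfl fun u hu => Function.update_of_ne (hne u hu) _ _
      rw [Finset.coe_insert, Set.insert_pi, hpi', ← hpi]
      ext c
      simp only [List.length_append, List.length_singleton, walkVertex, Function.update_self,
        Set.mem_ofPred_eq, Set.mem_inter_iff, Set.mem_preimage, Set.mem_singleton_iff,
        Function.eval]
      constructor
      · intro h
        obtain ⟨h1, h2⟩ := List.append_inj' h rfl
        rw [h1] at h2
        exact ⟨Fin.ext (by simpa using h2), h1⟩
      · rintro ⟨h1, h2⟩
        rw [h2, h1]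
    · rw [Finset.prod_insert hvs, Function.update_self,
        Finset.prod_congr rfl fun u hu => by rw [Function.update_of_ne (hne u hu)], hprod,
        show v ++ [i] = v ++ [((⟨i, hi⟩ : Fin (N v)) : ℕ)] from rfl, hF, mul_comm]

lemma measurableSet_walkVertex_eq (n : ℕ) (v : List ℕ) :
    MeasurableSet {c : ∀ v, Fin (N v) | walkVertex c n = v} := by
  induction n generalizing v with
  | zero => exact MeasurableSet.const ([] = v)
  | succ n ih =>
    have h : {c : ∀ v, Fin (N v) | walkVertex c (n + 1) = v}
        = ⋃ u, {c | walkVertex c n = u} ∩ {c | u ++ [(c u : ℕ)] = v} := by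
      ext c
      simp [walkVertex]
    rw [h]
    refine MeasurableSet.iUnion fun u => (ih u).inter ?_
    exact (MeasurableSet.of_discrete (s := {j : Fin (N u) | u ++ [(j : ℕ)] = v})).preimage
      (measurable_pi_apply u)

lemma measurable_walkPath : Measurable (walkPath (N := N)) := by
  refine Measurable.subtype_mk (measurable_pi_iff.2 fun n => measurable_to_countable' fun k => ?_)
  have h : (fun c : ∀ v, Fin (N v) => (c (walkVertex c n) : ℕ)) ⁻¹' {k}
      = ⋃ u, {c | walkVertex c n = u} ∩ {c | (c u : ℕ) = k} := by
    ext c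
    simp
  rw [h]
  refine MeasurableSet.iUnion fun u => (measurableSet_walkVertex_eq n u).inter ?_
  exact (MeasurableSet.of_discrete (s := {j : Fin (N u) | (j : ℕ) = k})).preimage
    (measurable_pi_apply u)

/-- A positive function `w` on the vertices with `m * w v` equal to the sum of `w` over the children
of `v` defines a flow: the law of the path that moves from `v` to its child `v ++ [i]` with
probability `w (v ++ [i]) / (m * w v)`, independently at all vertices. -/
theorem exists_flow {m : ℝ} (hm : 0 < m) {w : List ℕ → ℝ} (hpos : ∀ v, 0 < w v)
    (hadd : ∀ v, ∑ i ∈ Finset.range (N v), w (v ++ [i]) = m * w v) :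
    ∃ θ : ProbabilityMeasure (familyTree N).boundary, ∀ n, ∀ v ∈ generation N n,
      (θ : Measure (familyTree N).boundary) (pathsThrough (familyTree N) v)
        = ENNReal.ofReal (w v / (m ^ n * w [])) := by
  have hmw : ∀ v, 0 < m * w v := fun v => mul_pos hm (hpos v)
  let p : ∀ v, PMF (Fin (N v)) := fun v =>
    PMF.ofFintype (fun i => ENNReal.ofReal (w (v ++ [(i : ℕ)]) / (m * w v))) (by
      rw [← ENNReal.ofReal_sum_of_nonneg fun i _ => (div_pos (hpos _) (hmw v)).le,
        ← Finset.sum_div, Fin.sum_univ_eq_sum_range (fun i => w (v ++ [i])), hadd,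
        div_self (hmw v).ne', ENNReal.ofReal_one])
  let P : Measure (∀ v, Fin (N v)) := Measure.infinitePi fun v => (p v).toMeasure
  have hP : IsProbabilityMeasure P := by
    dsimp only [P]
    infer_instance
  refine ⟨⟨P.map walkPath, Measure.isProbabilityMeasure_map measurable_walkPath.aemeasurable⟩,
    fun n v hv => ?_⟩
  obtain ⟨rfl, hvN⟩ := mem_generation.1 hv
  obtain ⟨s, c₀, -, hpi, hprod⟩ := exists_walkVertex_eq_pi hvN (fun v => (p v).toMeasure)
    (F := fun v => ENNReal.ofReal (w v / (m ^ v.length * w []))) (by simp [(hpos []).ne']) (by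
      intro v i
      rw [PMF.toMeasure_apply_singleton _ _ (measurableSet_singleton i), PMF.ofFintype_apply,
        ← ENNReal.ofReal_mul (div_pos (hpos v) (mul_pos (pow_pos hm _) (hpos []))).le]
      congr 1
      have := (hpos v).ne'
      have := (hpos []).ne'
      simp only [List.length_append, List.length_singleton]
      field_simp
      ring)
  rw [ProbabilityMeasure.coe_mk, Measure.map_apply measurable_walkPath
    (measurableSet_pathsThrough _ _)]
  have hpre : walkPath ⁻¹' pathsThrough (familyTree N) v
      = {c : ∀ v, Fin (N v) | walkVertex c v.length = v} := by
    ext c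
    simp [pathsThrough, vertexAt_walkPath]
  rw [hpre, hpi, Measure.infinitePi_pi _ fun _ _ => MeasurableSet.of_discrete, hprod]

end flow

/-! ### Capacity of a tree with regular growth -/

/-- If the generation sizes are at most of order `m ^ n`, then positive capacity in gauge `f` forces
the series of `f` to converge. -/
theorem summable_of_cap_pos {m : ℝ} (hm : 1 < m) {N : List ℕ → ℕ} {C : ℝ}
    (hC : ∀ n, normSize m n N ≤ C) {f : ℕ → ℝ} (hf : IsIncreasingGauge f)
    (hcap : 0 < (familyTree N).cap f) :
    Summable (fun n : ℕ => (m ^ (n + 1))⁻¹ * f (n + 1)) := by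
  have hm0 : 0 < m := by linarith
  obtain ⟨θ, hθ⟩ := cap_pos_iff.1 hcap
  rw [energy_eq_tsum hf] at hθ
  have hfin := (ENNReal.add_ne_top.1 hθ).2
  have hC1 : 0 < C := by
    have := hC 0
    simp [normSize] at this
    linarith
  rw [summable_gauge_iff hm hf]
  have hle : ∀ n, ENNReal.ofReal (f (n + 1) - f n) * ENNReal.ofReal (m ^ (n + 1))⁻¹
      ≤ ENNReal.ofReal C * (ENNReal.ofReal (f (n + 1) - f n) * ∑ v ∈ generation N (n + 1),
        (θ : Measure (familyTree N).boundary) (pathsThrough (familyTree N) v) ^ 2) := by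
    intro n
    rw [mul_left_comm]
    gcongr
    refine le_trans ?_ (mul_le_mul_right (inv_card_generation_le
      (θ : Measure (familyTree N).boundary) (n + 1)) _)
    have h := hC (n + 1)
    rw [normSize, genSum_const_one, div_le_iff₀ (by positivity)] at h
    have h' : ((generation N (n + 1)).card : ℝ≥0∞)
        ≤ ENNReal.ofReal C * ENNReal.ofReal (m ^ (n + 1)) := by
      rw [← ENNReal.ofReal_mul hC1.le, ← ENNReal.ofReal_natCast]
      exact ENNReal.ofReal_le_ofReal h
    have hCne : ENNReal.ofReal C ≠ 0 := by simpa using hC1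
    calc ENNReal.ofReal (m ^ (n + 1))⁻¹
        = ENNReal.ofReal C * (ENNReal.ofReal C * ENNReal.ofReal (m ^ (n + 1)))⁻¹ := by
          rw [ENNReal.mul_inv (Or.inl hCne) (Or.inl ENNReal.ofReal_ne_top), ← mul_assoc,
            ENNReal.mul_inv_cancel hCne ENNReal.ofReal_ne_top, one_mul,
            ENNReal.ofReal_inv_of_pos (by positivity)]
      _ ≤ _ := by gcongr
  refine ne_top_of_le_ne_top ?_ (ENNReal.tsum_le_tsum hle)
  rw [ENNReal.tsum_mul_left]
  exact ENNReal.mul_ne_top ENNReal.ofReal_ne_top hfin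

/-- If `w` is a positive additive function on the vertices whose squares have sums of order at most
`m ^ n` over the generations, then the flow of `w` has finite energy for every gauge with convergent
series. -/
theorem cap_pos_of_summable {m : ℝ} (hm : 1 < m) {N : List ℕ → ℕ} {w : List ℕ → ℝ}
    (hpos : ∀ v, 0 < w v) (hadd : ∀ v, ∑ i ∈ Finset.range (N v), w (v ++ [i]) = m * w v)
    {C : ℝ} (hC : ∀ n, ∑ v ∈ generation N n, w v ^ 2 ≤ C * m ^ n) {f : ℕ → ℝ}
    (hf : IsIncreasingGauge f) (hsum : Summable (fun n : ℕ => (m ^ (n + 1))⁻¹ * f (n + 1))) :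
    0 < (familyTree N).cap f := by
  have hm0 : 0 < m := by linarith
  obtain ⟨θ, hθ⟩ := exists_flow hm0 hpos hadd
  refine cap_pos_iff.2 ⟨θ, ?_⟩
  rw [energy_eq_tsum hf]
  refine ENNReal.add_ne_top.2 ⟨ENNReal.ofReal_ne_top, ?_⟩
  have hle : ∀ n, ENNReal.ofReal (f (n + 1) - f n) * ∑ v ∈ generation N (n + 1),
      (θ : Measure (familyTree N).boundary) (pathsThrough (familyTree N) v) ^ 2
      ≤ ENNReal.ofReal (C / w [] ^ 2)
        * (ENNReal.ofReal (f (n + 1) - f n) * ENNReal.ofReal (m ^ (n + 1))⁻¹) := by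
    intro n
    have h0 := hpos []
    rw [mul_left_comm]
    gcongr
    rw [Finset.sum_congr rfl fun v hv => by
        rw [hθ (n + 1) v hv, ← ENNReal.ofReal_pow (by have := hpos v; positivity)],
      ← ENNReal.ofReal_sum_of_nonneg fun v _ => by positivity,
      ← ENNReal.ofReal_mul' (by positivity)]
    refine ENNReal.ofReal_le_ofReal ?_
    simp only [div_pow]
    rw [← Finset.sum_div, div_le_iff₀ (by positivity)]
    refine (hC (n + 1)).trans_eq ?_
    field_simp
  refine ne_top_of_le_ne_top ?_ (ENNReal.tsum_le_tsum hle)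
  rw [ENNReal.tsum_mul_left]
  exact ENNReal.mul_ne_top ENNReal.ofReal_ne_top ((summable_gauge_iff hm hf).1 hsum)

/-- Almost every Galton–Watson tree has positive capacity exactly for the gauges with convergent
series. -/
theorem ae_cap_pos_iff_summable (q : PMF ℕ) (m : ℝ) (hq0 : q 0 = 0) (hq1 : q 1 ≠ 1)
    (hmean : HasSum (fun n : ℕ => (n : ℝ) * (q n).toReal) m)
    (hvar : Summable (fun n : ℕ => (n : ℝ) ^ 2 * (q n).toReal)) :
    ∀ᵐ N ∂(galtonWatson q), ∀ f : ℕ → ℝ, IsIncreasingGauge f →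
      (0 < (familyTree N).cap f ↔ Summable (fun n : ℕ => (m ^ (n + 1))⁻¹ * f (n + 1))) := by
  have hm := one_lt_mean hq0 hq1 hmean
  have hm0 : 0 < m := by linarith
  obtain ⟨W, hW, hW2, hlim, hne⟩ := exists_limit_normSize hm hmean hvar
  have hbdd : ∀ᵐ N ∂galtonWatson q, ∃ C, ∀ n, normSize m n N ≤ C := by
    filter_upwards [hlim] with N hN
    obtain ⟨C, hC⟩ := hN.bddAbove_range
    exact ⟨C, fun n => hC ⟨n, rfl⟩⟩
  filter_upwards [hbdd, ae_forall_below hlim, ae_forall_limit_pos hm0 hq0 hq1 hW hlim hne,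
    ae_exists_genSum_le hm (lintegral_natCast_toMeasure hmean) hbdd (hW.pow_const 2)
      (fun N => sq_nonneg _) hW2.integrable_sq] with N ⟨C, hC⟩ hN hpos ⟨C', hC'⟩ f hf
  refine ⟨summable_of_cap_pos hm hC hf, cap_pos_of_summable hm hpos (fun v => ?_) hC' hf⟩
  have h := genSum_one_limit hm0 (N := below N v) (W := W) fun u => by
    rw [← below_append]
    exact hN _
  simp only [genSum_one, ← below_append] at h
  rw [← h]
  simp [below]

theorem theorem4p1 (q : PMF ℕ) (m : ℝ)
    (hq0 : q 0 = 0) (hq1 : q 1 ≠ 1)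
    (hmean : HasSum (fun n : ℕ => (n : ℝ) * (q n).toReal) m)
    (hvar : Summable (fun n : ℕ => (n : ℝ) ^ 2 * (q n).toReal)) :
    (∀ᵐ N ∂(galtonWatson q), ∀ f : ℕ → ℝ, IsIncreasingGauge f →
      (0 < (familyTree N).cap f ↔ Summable (fun n : ℕ => (m ^ (n + 1))⁻¹ * f (n + 1)))) ∧
    (∀ q' : PMF ℕ, q' 0 = 0 →
      HasSum (fun n : ℕ => (n : ℝ) * (q' n).toReal) m →
      Summable (fun n : ℕ => (n : ℝ) ^ 2 * (q' n).toReal) →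
      ∀ᵐ p ∂((galtonWatson q).prod (galtonWatson q')),
        WordTree.CapacityEquivalent (familyTree p.1) (familyTree p.2)) := by
  refine ⟨ae_cap_pos_iff_summable q m hq0 hq1 hmean hvar, fun q' hq0' hmean' hvar' => ?_⟩
  -- As the mean `m` exceeds `1`, the distribution `q'` is not concentrated at `1` either.
  have hq1' : q' 1 ≠ 1 := by
    intro h1
    have hz : ∀ n : ℕ, n ≠ 1 → (n : ℝ) * (q' n).toReal = 0 := fun n hn => by
      have : q' n = 0 := by
        rw [PMF.apply_eq_zero_iff, (PMF.apply_eq_one_iff q' 1).1 h1]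
        exact hn
      simp [this]
    have hm1 := hmean'.unique (hasSum_single 1 hz)
    have := one_lt_mean hq0 hq1 hmean
    simp [h1] at hm1
    linarith
  filter_upwards [Measure.quasiMeasurePreserving_fst.ae
      (ae_cap_pos_iff_summable q m hq0 hq1 hmean hvar),
    Measure.quasiMeasurePreserving_snd.ae
      (ae_cap_pos_iff_summable q' m hq0' hq1' hmean' hvar')] with p h1 h2 f hf
  rw [h1 f hf, h2 f hf]
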